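/- All graphs are finite and simple (in particular, without loops). For graphs $F,G$ we say that $G$ is $F$-free if no induced subgraph of $G$ is isomorphic to $F$, and $\{P_5,F\}$-free if it is both $P_5$-free and $F$-free, where $P_5$ is the path on $5$ vertices. A graph $F$ is a threshold graph if $V(F)$ can be partitioned into an independent set $A$ and a clique $B$ (either may be empty) such that for all $a,a'\in A$ we have $N(a)\supseteq N(a')$ or $N(a)\subseteq N(a')$. For graphs $G,H$, a partial $H$-coloring of $G$ is a partial function $\phi\colon V(G)\rightharpoonup V(H)$ such that $\phi(u)\phi(v)\in E(H)$ for every edge $uv\in E(G)$ with $u,v\in\mathrm{dom}\,\phi$. Given a function $\mathsf{rev}\colon V(G)\times V(H)\to\mathbb{R}$ (negative values are allowed), the revenue of $\phi$ is $\mathsf{rev}(\phi)=\sum_{u\in\mathrm{dom}\,\phi}\mathsf{rev}(u,\phi(u))$. For a fixed graph $H$, the problem Max Partial $H$-Coloring is: given a graph $G$ and a function $\mathsf{rev}\colon V(G)\times V(H)\to\mathbb{R}$, output a partial $H$-coloring $\phi$ of $G$ that maximizes $\mathsf{rev}(\phi)$ among all partial $H$-colorings of $G$. **Theorem.** For every fixed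 threshold graph $F$ and every fixed graph $H$ without loops, Max Partial $H$-Coloring can be solved in polynomial time on $\{P_5,F\}$-free graphs. That is, there are an algorithm and a polynomial $T$, both depending only on $F$ and $H$, such that for every $\{P_5,F\}$-free graph $G$ on $n$ vertices and every $\mathsf{rev}\colon V(G)\times V(H)\to\mathbb{R}$, the algorithm, given the adjacency matrix of $G$ and the matrix $\mathsf{rev}$, halts after at most $T(n)$ steps and outputs an optimum solution $\phi$. Here an algorithm is a program for a unit-cost random access machine with integer and real memory cells, whose operations on numbers are addition, subtraction and comparison, with no real constants other than $0$ and $1$. -/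

import Mathlib

/-! ## Graphs: induced subgraphs, threshold graphs -/

/-- `G` is `F`-free: no induced subgraph of `G` is isomorphic to `F`. -/
def IndFree {U V : Type*} (F : SimpleGraph U) (G : SimpleGraph V) : Prop :=
  ¬ F.IsIndContained G

/-- `F` is a threshold graph: its vertex set can be partitioned into an independent set `A` and
a clique `B` so that the neighbourhoods of the vertices of `A` are pairwise comparable. -/
def IsThresholdGraph {U : Type*} (F : SimpleGraph U) : Prop :=
  ∃ A B : Set U, A ∪ B = Set.univ ∧ Disjoint A B ∧ F.IsIndepSet A ∧ F.IsClique B ∧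
    ∀ a ∈ A, ∀ a' ∈ A, F.neighborSet a' ⊆ F.neighborSet a ∨ F.neighborSet a ⊆ F.neighborSet a'

/-! ## Partial `H`-colorings and their revenue

A partial function from `V` to `W` is a map `φ : V → Option W`; its domain is the set of all `v`
with `φ v ≠ none`. -/

/-- `φ` is a homomorphism to `H` from the subgraph of `G` induced by the domain of `φ`. -/
def IsPartialColoring {V W : Type*} (G : SimpleGraph V) (H : SimpleGraph W)
    (φ : V → Option W) : Prop :=
  ∀ u v a b, G.Adj u v → φ u = some a → φ v = some b → H.Adj a b

/-- The revenue of `φ`: the sum of `rev v (φ v)` over all `v` in the domain of `φ`. -/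
def revenue {V W : Type*} [Fintype V] (rev : V → W → ℝ) (φ : V → Option W) : ℝ :=
  ∑ v, (φ v).elim 0 (rev v)

/-- `φ` is an optimum solution of the instance `(G, rev)` of Max Partial `H`-Coloring. -/
def IsOptimumSolution {V W : Type*} [Fintype V] (G : SimpleGraph V) (H : SimpleGraph W)
    (rev : V → W → ℝ) (φ : V → Option W) : Prop :=
  IsPartialColoring G H φ ∧
    ∀ ψ : V → Option W, IsPartialColoring G H ψ → revenue rev ψ ≤ revenue rev φ

/-! ## The machine model: a unit-cost random access machine with real registers

Programs are finite while-programs over integer and real variables and two-dimensional integer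
and real arrays, all of them named by natural numbers. Array indices are computed at run time.
The operations on numbers are the constants, addition, subtraction and comparison, each at unit
cost. Real constants are restricted to `0` and `1`. There is no multiplication, no rounding and
no conversion of a real into an integer, so polynomially many steps cannot hide more than
polynomial work. -/

namespace RealRAM

/-- The contents of the memory. -/
structure State where
  /-- integer variables -/
  ivar : ℕ → ℕ
  /-- real variables -/
  rvar : ℕ → ℝ
  /-- integer arrays: `iarr k i j` is the entry `(i, j)` of the array named `k` -/
  iarr : ℕ → ℕ → ℕ → ℕ
  /-- real arrays: `rarr k i j` is the entry `(i, j)` of the array named `k` -/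
  rarr : ℕ → ℕ → ℕ → ℝ

/-- Integer expressions. -/
inductive IExp : Type
  | const (c : ℕ)
  | var (x : ℕ)
  | read (k : ℕ) (i j : IExp)
  | add (a b : IExp)
  | sub (a b : IExp)

/-- Real expressions. -/
inductive RExp : Type
  | zero
  | one
  | var (x : ℕ)
  | read (k : ℕ) (i j : IExp)
  | add (a b : RExp)
  | sub (a b : RExp)

/-- Tests. -/
inductive Test : Type
  | ile (a b : IExp)
  | rle (a b : RExp)
  | neg (t : Test)
  | and (s t : Test)

/-- Programs. -/
inductive Prog : Type
  | skip
  | setI (x : ℕ) (e : IExp)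
  | setR (x : ℕ) (e : RExp)
  | writeI (k : ℕ) (i j : IExp) (e : IExp)
  | writeR (k : ℕ) (i j : IExp) (e : RExp)
  | seq (p q : Prog)
  | cond (t : Test) (p q : Prog)
  | loop (t : Test) (p : Prog)

/-- The value of an integer expression; subtraction is truncated at `0`. -/
def IExp.eval (s : State) : IExp → ℕ
  | .const c => c
  | .var x => s.ivar x
  | .read k i j => s.iarr k (i.eval s) (j.eval s)
  | .add a b => a.eval s + b.eval s
  | .sub a b => a.eval s - b.eval s

/-- The value of a real expression. -/
noncomputable def RExp.eval (s : State) : RExp → ℝ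
  | .zero => 0
  | .one => 1
  | .var x => s.rvar x
  | .read k i j => s.rarr k (i.eval s) (j.eval s)
  | .add a b => a.eval s + b.eval s
  | .sub a b => a.eval s - b.eval s

/-- The outcome of a test. -/
def Test.holds (s : State) : Test → Prop
  | .ile a b => a.eval s ≤ b.eval s
  | .rle a b => a.eval s ≤ b.eval s
  | .neg t => ¬ t.holds s
  | .and t u => t.holds s ∧ u.holds s

/-- The number of steps to evaluate an integer expression: one for each operation or operand. -/
def IExp.cost : IExp → ℕ
  | .const _ => 1
  | .var _ => 1
  | .read _ i j => i.cost + j.cost + 1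
  | .add a b => a.cost + b.cost + 1
  | .sub a b => a.cost + b.cost + 1

/-- The number of steps to evaluate a real expression. -/
def RExp.cost : RExp → ℕ
  | .zero => 1
  | .one => 1
  | .var _ => 1
  | .read _ i j => i.cost + j.cost + 1
  | .add a b => a.cost + b.cost + 1
  | .sub a b => a.cost + b.cost + 1

/-- The number of steps to evaluate a test. -/
def Test.cost : Test → ℕ
  | .ile a b => a.cost + b.cost + 1
  | .rle a b => a.cost + b.cost + 1
  | .neg t => t.cost + 1
  | .and t u => t.cost + u.cost + 1

/-- The entry `(i, j)` of the array named `k` is replaced by `x`; nothing else changes. -/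
def update3 {α : Type} (f : ℕ → ℕ → ℕ → α) (k i j : ℕ) (x : α) : ℕ → ℕ → ℕ → α :=
  fun k' i' j' => if k' = k ∧ i' = i ∧ j' = j then x else f k' i' j'

/-- `Runs p s s' t`: the program `p`, started in the state `s`, halts in the state `s'` after
exactly `t` steps. -/
inductive Runs : Prog → State → State → ℕ → Prop
  | skip (s : State) : Runs .skip s s 1
  | setI (s : State) (x : ℕ) (e : IExp) :
      Runs (.setI x e) s { s with ivar := Function.update s.ivar x (e.eval s) } (e.cost + 1)
  | setR (s : State) (x : ℕ) (e : RExp) :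
      Runs (.setR x e) s { s with rvar := Function.update s.rvar x (e.eval s) } (e.cost + 1)
  | writeI (s : State) (k : ℕ) (i j e : IExp) :
      Runs (.writeI k i j e) s
        { s with iarr := update3 s.iarr k (i.eval s) (j.eval s) (e.eval s) }
        (i.cost + j.cost + e.cost + 1)
  | writeR (s : State) (k : ℕ) (i j : IExp) (e : RExp) :
      Runs (.writeR k i j e) s
        { s with rarr := update3 s.rarr k (i.eval s) (j.eval s) (e.eval s) }
        (i.cost + j.cost + e.cost + 1)
  | seq {p q : Prog} {s s' s'' : State} {t t' : ℕ} :
      Runs p s s' t → Runs q s' s'' t' → Runs (.seq p q) s s'' (t + t')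
  | condTrue {b : Test} {p q : Prog} {s s' : State} {t : ℕ} :
      b.holds s → Runs p s s' t → Runs (.cond b p q) s s' (b.cost + t)
  | condFalse {b : Test} {p q : Prog} {s s' : State} {t : ℕ} :
      ¬ b.holds s → Runs q s s' t → Runs (.cond b p q) s s' (b.cost + t)
  | loopDone {b : Test} {p : Prog} {s : State} :
      ¬ b.holds s → Runs (.loop b p) s s b.cost
  | loopStep {b : Test} {p : Prog} {s s' s'' : State} {t t' : ℕ} :
      b.holds s → Runs p s s' t → Runs (.loop b p) s' s'' t' →
      Runs (.loop b p) s s'' (b.cost + t + t')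

end RealRAM

/-! ## Max Partial `H`-Coloring in polynomial time -/

open Classical in
/-- The initial state for the instance `(G, rev)`: the number `n` of vertices is in the integer
variable `0`, the adjacency matrix of `G` is in the integer array `0`, and the matrix of revenues
is in the real array `0`; everything else is `0`. -/
noncomputable def inputState {n h : ℕ} (G : SimpleGraph (Fin n)) (rev : Fin n → Fin h → ℝ) :
    RealRAM.State where
  ivar := fun x => if x = 0 then n else 0
  rvar := fun _ => 0
  iarr := fun k i j =>
    if k = 0 ∧ ∃ (hi : i < n) (hj : j < n), G.Adj ⟨i, hi⟩ ⟨j, hj⟩ then 1 else 0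
  rarr := fun k i c =>
    if hc : k = 0 ∧ i < n ∧ c < h then rev ⟨i, hc.2.1⟩ ⟨c, hc.2.2⟩ else 0

/-- The state `s` displays the partial function `φ` in column `0` of the integer array `1`:
entry `0` for a vertex outside the domain, and entry `c + 1` for a vertex mapped to `c`. -/
def Outputs {n h : ℕ} (s : RealRAM.State) (φ : Fin n → Option (Fin h)) : Prop :=
  ∀ v : Fin n, s.iarr 1 v 0 = (φ v).elim 0 (fun c => (c : ℕ) + 1)

/-- Max Partial `H`-Coloring can be solved in polynomial time on the class `𝒢` of graphs: one
program and one polynomial `T` are such that, for every graph `G` of the class, with `n` vertices,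
and every real revenue function, the program halts within `T n` steps and outputs an optimum
solution. -/
def MaxPartialColoringInPolyTime {h : ℕ} (H : SimpleGraph (Fin h))
    (𝒢 : ∀ n : ℕ, SimpleGraph (Fin n) → Prop) : Prop :=
  ∃ (p : RealRAM.Prog) (T : Polynomial ℕ),
    ∀ (n : ℕ) (G : SimpleGraph (Fin n)) (rev : Fin n → Fin h → ℝ), 𝒢 n G →
      ∃ (s : RealRAM.State) (t : ℕ) (φ : Fin n → Option (Fin h)),
        RealRAM.Runs p (inputState G rev) s t ∧ t ≤ T.eval n ∧
          Outputs s φ ∧ IsOptimumSolution G H rev φ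

/-! A threshold graph is built from nothing by adding isolated and dominating vertices, so `F`
becomes a word over these two operations. The algorithm recurses on the word and on the number of
colors in the lists; it works with list instances because guesses shrink lists, and it treats
components separately.

The basic move separates the neighborhood of a vertex `u` from its non-neighbors. Color classes are
independent because `H` has no loops, and in a graph without induced `P₅` an independent subset of
`N(u)` contains two vertices that dominate everything the subset dominates outside `N[u]`
(`exists_pair_cover`). So it suffices to guess the color of `u` and one such pair for each color,
which leaves polynomially many choices. After the lists are pruned accordingly, the edges between
the two sides take care of themselves (`Valid.combine`), and for any given coloring some guess loses
nothing (`Valid.exists_prune`). The two sides are then solved independently.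

If the word starts with an isolated vertex, let `u` be a vertex colored by the optimum. Its
neighbors lose the color of `u`, so there are fewer colors; its non-neighbors avoid the shorter
word, since `u` could be added as an isolated vertex. If the word starts with a dominating vertex,
every neighborhood avoids the shorter word. By `exists_monitor` there are `d` and `s` such that each
component outside their closed neighborhoods lies in the neighborhood of some vertex, so two
consecutive moves, at `d` and at `s`, leave only parts whose components avoid the shorter word.

Membership in these classes is never tested. All guesses are tried, each of them yields a valid
coloring, and the best is kept; only optimality depends on the class (`Sol`). The depth of the
recursion depends on `F` and `H` alone, so the time is polynomial. The machine has no procedures: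
each level is a program of its own, placed in memory above its caller (`Solver`). Pruned lists and
components are described by formulas with bounded quantifiers, which are evaluated by exhaustive
search (`Fm.tri`); connectedness is of this form because components have diameter at most `3`. -/

/-! ## Graphs without induced paths on five vertices -/

namespace PartialColoring

variable {V : Type*} {G : SimpleGraph V}

/-- `G` has no induced path on five vertices. -/
def NoInducedP5 (G : SimpleGraph V) : Prop :=
  ∀ a b c d e, G.Adj a b → G.Adj b c → G.Adj c d → G.Adj d e →
    ¬ G.Adj a c → ¬ G.Adj a d → ¬ G.Adj a e → ¬ G.Adj b d → ¬ G.Adj b e → ¬ G.Adj c e → False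

/-- `a` and `b` are joined by a walk of length at most `3` inside `X`. In graphs without induced
paths on five vertices this means that they are in the same component of `G[X]`. -/
def Link (G : SimpleGraph V) (X : Set V) (a b : V) : Prop :=
  a ∈ X ∧ b ∈ X ∧ ∃ x ∈ X, ∃ y ∈ X,
    (a = x ∨ G.Adj a x) ∧ (x = y ∨ G.Adj x y) ∧ (y = b ∨ G.Adj y b)

/-- The vertices of `X` other than `u` and not adjacent to `u`. -/
def away (G : SimpleGraph V) (u : V) (X : Set V) : Set V :=
  {x | x ∈ X ∧ x ≠ u ∧ ¬ G.Adj u x}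

theorem Link.refl {X : Set V} {a : V} (ha : a ∈ X) : Link G X a a :=
  ⟨ha, ha, a, ha, a, ha, .inl rfl, .inl rfl, .inl rfl⟩

theorem Link.symm {X : Set V} {a b : V} (h : Link G X a b) : Link G X b a := by
  obtain ⟨ha, hb, x, hx, y, hy, h1, h2, h3⟩ := h
  exact ⟨hb, ha, y, hy, x, hx, h3.imp Eq.symm fun h => h.symm, h2.imp Eq.symm fun h => h.symm,
    h1.imp Eq.symm fun h => h.symm⟩

theorem Link.mono {X Y : Set V} (hXY : X ⊆ Y) {a b : V} (h : Link G X a b) : Link G Y a b := by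
  obtain ⟨ha, hb, x, hx, y, hy, h'⟩ := h
  exact ⟨hXY ha, hXY hb, x, hXY hx, y, hXY hy, h'⟩

/-- A walk with four edges has a shortcut or is an induced path on five vertices. This closure under
one more edge is what makes `Link` mean connectedness. -/
theorem Link.step (hG : NoInducedP5 G) {X : Set V} {a b c : V} (h : Link G X a b) (hc : c ∈ X)
    (hbc : b = c ∨ G.Adj b c) : Link G X a c := by
  obtain ⟨ha, hb, x, hx, y, hy, h1, h2, h3⟩ := h
  rcases hbc with rfl | hbc
  · exact ⟨ha, hb, x, hx, y, hy, h1, h2, h3⟩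
  rcases h1 with rfl | h1
  · exact ⟨ha, hc, y, hy, b, hb, h2, h3, .inr hbc⟩
  rcases h2 with rfl | h2
  · exact ⟨ha, hc, x, hx, b, hb, .inr h1, h3, .inr hbc⟩
  rcases h3 with rfl | h3
  · exact ⟨ha, hc, x, hx, y, hy, .inr h1, .inr h2, .inr hbc⟩
  by_contra hn
  refine hG a x y b c h1 h2 h3 hbc ?_ ?_ ?_ ?_ ?_ ?_ <;> intro h <;> apply hn
  · exact ⟨ha, hc, y, hy, b, hb, .inr h, .inr h3, .inr hbc⟩
  · exact ⟨ha, hc, b, hb, b, hb, .inr h, .inl rfl, .inr hbc⟩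
  · exact ⟨ha, hc, a, ha, a, ha, .inl rfl, .inl rfl, .inr h⟩
  · exact ⟨ha, hc, x, hx, b, hb, .inr h1, .inr h, .inr hbc⟩
  · exact ⟨ha, hc, x, hx, x, hx, .inr h1, .inl rfl, .inr h⟩
  · exact ⟨ha, hc, x, hx, y, hy, .inr h1, .inr h2, .inr h⟩

theorem Link.trans (hG : NoInducedP5 G) {X : Set V} {a b c : V} (h : Link G X a b)
    (h' : Link G X b c) : Link G X a c := by
  obtain ⟨_, hc, x, hx, y, hy, h1, h2, h3⟩ := h'
  exact ((h.step hG hx h1).step hG hy h2).step hG hc h3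

/-- A property that holds at `a` but not at `b` changes along some edge of the component. -/
theorem Link.exists_edge (hG : NoInducedP5 G) {X : Set V} {a b : V} (h : Link G X a b)
    (P : V → Prop) (ha : P a) (hb : ¬ P b) :
    ∃ p q, Link G X a p ∧ Link G X a q ∧ G.Adj p q ∧ P p ∧ ¬ P q := by
  obtain ⟨hax, hbx, x, hx, y, hy, h1, h2, h3⟩ := h
  have lx := (Link.refl (G := G) hax).step hG hx h1
  have ly := lx.step hG hy h2
  have lb := ly.step hG hbx h3
  by_cases px : P x
  · by_cases py : P y
    · rcases h3 with rfl | h3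
      · exact absurd py hb
      · exact ⟨y, b, ly, lb, h3, py, hb⟩
    · rcases h2 with rfl | h2
      · exact absurd px py
      · exact ⟨x, y, lx, ly, h2, px, py⟩
  · rcases h1 with rfl | h1
    · exact absurd ha px
    · exact ⟨a, x, .refl hax, lx, h1, ha, px⟩

/-! ### Dominating pairs and monitors -/

/-- Among the vertices of an independent set in the neighborhood of `u` there are two that dominate
everything that the set dominates outside of the closed neighborhood of `u`. -/
theorem exists_pair_cover (hG : NoInducedP5 G) (u : V) (A : Finset V) (hne : A.Nonempty)
    (hA : ∀ v ∈ A, G.Adj u v) (hind : ∀ v ∈ A, ∀ w ∈ A, ¬ G.Adj v w) :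
    ∃ p ∈ A, ∃ q ∈ A, ∀ w ∈ A, ∀ z, ¬ G.Adj u z → G.Adj w z → G.Adj p z ∨ G.Adj q z := by
  -- A pair is chosen whose joint neighborhood outside that of `u` is maximal under inclusion.
  let f : V × V → Set V := fun x => {z | ¬ G.Adj u z ∧ (G.Adj x.1 z ∨ G.Adj x.2 z)}
  obtain ⟨⟨p, q⟩, hm, hmax⟩ := (A ×ˢ A).exists_maximalFor f (hne.product hne)
  obtain ⟨hp, hq⟩ := Finset.mem_product.mp hm
  refine ⟨p, hp, q, hq, fun w hw z huz hwz => ?_⟩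
  by_contra hz
  -- Otherwise replacing `r` by `w` would lose nothing and gain `z`. So each of `p` and `q` has a
  -- private neighbor, missed by the other one and by `w`.
  have key : ∀ r ∈ A, ∀ t ∈ A, f (p, q) = f (r, t) → ∃ x, ¬ G.Adj u x ∧ G.Adj r x ∧
      ¬ G.Adj t x ∧ ¬ G.Adj w x := by
    intro r hr t ht he
    by_contra hno
    have h1 : f (p, q) ≤ f (t, w) := by
      rw [he]
      rintro x ⟨hx, h | h⟩
      · refine ⟨hx, ?_⟩
        by_contra h'
        exact hno ⟨x, hx, h, fun h2 => h' (.inl h2), fun h2 => h' (.inr h2)⟩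
      · exact ⟨hx, .inl h⟩
    exact hz (hmax (Finset.mem_product.mpr ⟨ht, hw⟩) h1 ⟨huz, .inr hwz⟩).2
  obtain ⟨x, hux, hpx, hqx, hwx⟩ := key p hp q hq rfl
  obtain ⟨y, huy, hqy, hpy, hwy⟩ := key q hq p hp (by ext z; simp [f, or_comm])
  -- Nonadjacent private neighbors give the induced path `x p u q y`, adjacent ones give `y x p u
  -- w`.
  have hxy : G.Adj x y := by
    by_contra hxy
    exact hG x p u q y hpx.symm (hA p hp).symm (hA q hq) hqy (fun h => hux h.symm)
      (fun h => hqx h.symm) hxy (hind p hp q hq) hpy huy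
  exact hG y x p u w hxy.symm hpx.symm (hA p hp).symm (hA w hw) (fun h => hpy h.symm)
    (fun h => huy h.symm) (fun h => hwy h.symm) (fun h => hux h.symm) (fun h => hwx h.symm)
    (hind p hp w hw)

theorem away_subset (u : V) (X : Set V) : away G u X ⊆ X := fun _ h => h.1

/-- Every component of `G[X]` minus the closed neighborhood of `d` is attached to a neighbor
of `d`. -/
theorem exists_attachment (hG : NoInducedP5 G) {X : Set V}
    (hX : ∀ a ∈ X, ∀ b ∈ X, Link G X a b) {d c : V} (hd : d ∈ X) (hc : c ∈ away G d X) :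
    ∃ s ∈ X, G.Adj d s ∧ ∃ x, Link G (away G d X) c x ∧ G.Adj s x := by
  -- On the way to `d` some edge leaves the component of `c`. Its outer end is not `d`, and if it
  -- were not adjacent to `d` it would belong to the component.
  obtain ⟨x, s, -, hs, hxs, hx, hns⟩ := (hX c hc.1 d hd).exists_edge hG
    (fun y => Link G (away G d X) c y) (.refl hc) (fun h => h.2.1.2.1 rfl)
  have hsX := hs.2.1
  refine ⟨s, hsX, ?_, x, hx, hxs.symm⟩
  by_contra hds
  by_cases hsd : s = d
  · subst hsd
    exact hx.2.1.2.2 hxs.symm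
  · exact hns (hx.step hG ⟨hsX, hsd, hds⟩ (.inr hxs))

/-- A connected graph without induced paths on five vertices has two vertices `d` and `s` such
that every component outside of their closed neighborhoods is contained in the neighborhood of a
vertex. -/
theorem exists_monitor (hG : NoInducedP5 G) {X : Set V} (hfin : X.Finite)
    (hX : ∀ a ∈ X, ∀ b ∈ X, Link G X a b) {r : V} (hr : r ∈ X) :
    ∃ d ∈ X, ∃ s ∈ X, ∀ c ∈ away G s (away G d X),
      ∃ w ∈ X, ∀ y, Link G (away G s (away G d X)) c y → G.Adj w y := by
  -- Bad pairs `(d, c)`: no vertex is adjacent to the whole component of `c` outside the closed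
  -- neighborhood of `d`. Without bad pairs any vertex serves as `d` and `s`; otherwise a bad pair
  -- with the smallest component is taken.
  let bad : Set (V × V) := {x | x.1 ∈ X ∧ x.2 ∈ away G x.1 X ∧
    ∀ w ∈ X, ∃ y, Link G (away G x.1 X) x.2 y ∧ ¬ G.Adj w y}
  by_cases hbad : bad.Nonempty
  swap
  · refine ⟨r, hr, r, hr, fun c hc => ?_⟩
    by_contra hno
    push Not at hno
    refine hbad ⟨(r, c), hr, hc.1, fun w hw => ?_⟩
    obtain ⟨y, hy, hwy⟩ := hno w hw
    exact ⟨y, hy.mono (away_subset _ _), hwy⟩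
  have hfc : ∀ d c, {y | Link G (away G d X) c y}.Finite := fun d c =>
    hfin.subset fun y hy => hy.2.1.1
  let size : V × V → ℕ := fun x => {y | Link G (away G x.1 X) x.2 y}.ncard
  obtain ⟨⟨d, c⟩, ⟨hd, hc, hdc⟩, hmin⟩ : ∃ z ∈ bad, ∀ x ∈ bad, size z ≤ size x :=
    ⟨_, Function.argminOn_mem size bad hbad, fun x hx => Function.argminOn_le size bad hx⟩
  dsimp only at hd hc hdc hmin
  -- A vertex attached to the bad component is not adjacent to all of it, so it distinguishes the
  -- ends of some edge there.
  have mixed : ∀ s ∈ X, (∃ x, Link G (away G d X) c x ∧ G.Adj s x) →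
      ∃ p q, Link G (away G d X) c p ∧ Link G (away G d X) c q ∧ G.Adj p q ∧
        G.Adj s p ∧ ¬ G.Adj s q := by
    rintro s hs ⟨x, hx, hsx⟩
    obtain ⟨y, hy, hsy⟩ := hdc s hs
    obtain ⟨p, q, hp, hq, h⟩ := (hx.symm.trans hG hy).exists_edge hG (G.Adj s) hsx hsy
    exact ⟨p, q, hx.trans hG hp, hx.trans hG hq, h⟩
  obtain ⟨s, hs, hds, hsC⟩ := exists_attachment hG hX hd hc
  obtain ⟨x, y, hx, hy, hxy, hsx, hsy⟩ := mixed s hs hsC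
  refine ⟨d, hd, s, hs, fun c₂ hc₂ => ?_⟩
  have far : ∀ y, Link G (away G d X) c y → ¬ G.Adj d y ∧ ¬ G.Adj y d := fun y hy =>
    ⟨hy.2.1.2.2, fun h => hy.2.1.2.2 h.symm⟩
  by_cases hcc : Link G (away G d X) c c₂
  -- Inside the bad component: a neighbor `s'` of `d`, not adjacent to `s` and attached to the
  -- component of `c₂`, is adjacent to all of it, since otherwise `s d s' p₁ q₁` is an induced path.
  · by_cases hs' : ∃ s' ∈ X, G.Adj d s' ∧ ¬ G.Adj s s' ∧
        ∃ p, Link G (away G s (away G d X)) c₂ p ∧ G.Adj s' p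
    · obtain ⟨s', hs'X, hds', hss', p, hp, hs'p⟩ := hs'
      refine ⟨s', hs'X, fun z hz => ?_⟩
      by_contra hs'z
      obtain ⟨p₁, q₁, hp₁, hq₁, hpq, h1, h2⟩ :=
        (hp.symm.trans hG hz).exists_edge hG (G.Adj s') hs'p hs'z
      exact hG s d s' p₁ q₁ hds.symm hds' h1 hpq hss' hp₁.2.1.2.2 hq₁.2.1.2.2
        hp₁.2.1.1.2.2 hq₁.2.1.1.2.2 h2
    -- Without such an `s'` the component of `c₂` does not grow when only the closed neighborhood of
    -- `s` is removed. It misses `x`, so it is smaller than the bad component, and by minimality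
    -- `(s, c₂)` is not bad.
    · have hsub : ∀ y, Link G (away G s X) c₂ y → Link G (away G s (away G d X)) c₂ y := by
        intro z hz
        by_contra hnz
        obtain ⟨p, q, hp, hq, hpq, h1, h2⟩ := hz.exists_edge hG
          (fun y => Link G (away G s (away G d X)) c₂ y) (.refl hc₂) hnz
        have hqs := hq.2.1
        refine h2 (h1.step hG ⟨⟨hqs.1, ?_, ?_⟩, hqs.2⟩ (.inr hpq))
        · rintro rfl
          exact h1.2.1.1.2.2 hpq.symm
        · intro hdq
          exact hs' ⟨q, hqs.1, hdq, hqs.2.2, p, h1, hpq.symm⟩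
      have hc₂s : c₂ ∈ away G s X := ⟨hc₂.1.1, hc₂.2⟩
      have hlt : {y | Link G (away G s X) c₂ y}.ncard < {y | Link G (away G d X) c y}.ncard := by
        refine Set.ncard_lt_ncard ⟨fun z hz => ?_, fun h => ?_⟩ (hfc d c)
        · exact hcc.trans hG ((hsub z hz).mono (away_subset _ _))
        · exact (h hx : Link G (away G s X) c₂ x).2.1.2.2 hsx
      by_contra hno
      push Not at hno
      refine not_le.mpr hlt (hmin (s, c₂) (show _ ∧ _ ∧ _ from ⟨hs, hc₂s, fun w hw => ?_⟩))
      obtain ⟨z, hz, hwz⟩ := hno w hw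
      have hsub' : away G s (away G d X) ⊆ away G s X := fun a ha => ⟨ha.1.1, ha.2⟩
      exact ⟨z, hz.mono hsub', hwz⟩
  · have sep : ∀ p q, Link G (away G d X) c p → Link G (away G d X) c₂ q →
        ¬ G.Adj p q ∧ ¬ G.Adj q p := fun p q hp hq => by
      have : ¬ G.Adj p q := fun h =>
        hcc ((hp.step hG hq.2.1 (.inr h)).trans hG hq.symm)
      exact ⟨this, fun h => this h.symm⟩
    -- Otherwise `t` would be the middle of an induced path formed with an edge it distinguishes in
    -- the bad component and one in the component of `c₂`.
    have pure : ∀ t ∈ X, (∃ x, Link G (away G d X) c x ∧ G.Adj t x) →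
        ∀ p, Link G (away G d X) c₂ p → G.Adj t p →
          ∀ q, Link G (away G d X) c₂ q → G.Adj t q := by
      intro t ht htC p hp htp q hq
      by_contra htq
      obtain ⟨x₁, y₁, hx₁, hy₁, hxy₁, htx₁, hty₁⟩ := mixed t ht htC
      obtain ⟨x₂, y₂, hx₂, hy₂, hxy₂, htx₂, hty₂⟩ :=
        (hp.symm.trans hG hq).exists_edge hG (G.Adj t) htp htq
      have hx₂ := hp.trans hG hx₂
      have hy₂ := hp.trans hG hy₂
      exact hG y₁ x₁ t x₂ y₂ hxy₁.symm htx₁.symm htx₂ hxy₂ (fun h => hty₁ h.symm)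
        (sep _ _ hy₁ hx₂).1 (sep _ _ hy₁ hy₂).1 (sep _ _ hx₁ hx₂).1 (sep _ _ hx₁ hy₂).1 hty₂
    obtain ⟨s', hs', hds', x', hx', hs'x'⟩ := exists_attachment hG hX hd hc₂.1
    have hsx' : ¬ G.Adj s x' := fun h =>
      hc₂.2.2 (pure s hs hsC x' hx' h c₂ (.refl hc₂.1))
    -- If `s'` missed the bad component, then `y x s s' x'` or `y x s d s'` would be an induced
    -- path, according to whether `s` and `s'` are adjacent.
    have hs'C : ∃ x, Link G (away G d X) c x ∧ G.Adj s' x := by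
      by_contra hno
      push Not at hno
      by_cases hss' : G.Adj s s'
      · exact hG y x s s' x' hxy.symm hsx.symm hss' hs'x' (fun h => hsy h.symm)
          (fun h => hno y hy h.symm) (sep _ _ hy hx').1 (fun h => hno x hx h.symm)
          (sep _ _ hx hx').1 hsx'
      · exact hG y x s d s' hxy.symm hsx.symm hds.symm hds' (fun h => hsy h.symm) (far y hy).2
          (fun h => hno y hy h.symm) (far x hx).2 (fun h => hno x hx h.symm) hss'
    exact ⟨s', hs', fun z hz => pure s' hs' hs'C x' hx' hs'x' z (hz.mono (away_subset _ _))⟩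

/-! ## Threshold graphs as words -/

/-- The set `X` contains an induced copy of the threshold graph that is built from the empty graph
by adding isolated vertices (for `false`) and dominating vertices (for `true`), the last one
first. -/
def Contains (G : SimpleGraph V) : List Bool → Set V → Prop
  | [], _ => True
  | false :: w, X => ∃ u ∈ X, Contains G w (away G u X)
  | true :: w, X => ∃ u ∈ X, Contains G w {x | x ∈ X ∧ G.Adj u x}

theorem Contains.mono {w : List Bool} {X Y : Set V} (hXY : X ⊆ Y) (h : Contains G w X) :
    Contains G w Y := by
  induction w generalizing X Y with
  | nil => trivial
  | cons b w ih =>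
    cases b
    · obtain ⟨u, hu, h⟩ := h
      exact ⟨u, hXY hu, ih (fun x hx => ⟨hXY hx.1, hx.2⟩) h⟩
    · obtain ⟨u, hu, h⟩ := h
      exact ⟨u, hXY hu, ih (fun x hx => ⟨hXY hx.1, hx.2⟩) h⟩

/-- A nonempty induced subgraph of a threshold graph has an isolated or a dominating vertex. -/
theorem exists_isolated_or_dominating {U : Type*} {F : SimpleGraph U}
    (hF : IsThresholdGraph F) (S : Finset U) (hS : S.Nonempty) :
    ∃ x ∈ S, (∀ y ∈ S, ¬ F.Adj x y) ∨ ∀ y ∈ S, y ≠ x → F.Adj x y := by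
  classical
  obtain ⟨A, B, hAB, -, hA, hB, hcomp⟩ := hF
  have hor : ∀ x, x ∈ A ∨ x ∈ B := fun x => by
    have : x ∈ A ∪ B := hAB ▸ Set.mem_univ x
    exact this
  by_cases hSA : (S.filter (· ∈ A)).Nonempty
  · obtain ⟨a, ha, hmin⟩ := Finset.exists_min_image (S.filter (· ∈ A))
      (fun a => (S.filter (F.Adj a)).card) hSA
    obtain ⟨haS, haA⟩ := Finset.mem_filter.mp ha
    by_cases hiso : ∀ y ∈ S, ¬ F.Adj a y
    · exact ⟨a, haS, .inl hiso⟩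
    · push Not at hiso
      obtain ⟨b, hbS, hab⟩ := hiso
      have hbB : b ∈ B := (hor b).resolve_left fun hb => hA haA hb hab.ne hab
      refine ⟨b, hbS, .inr fun y hy hyb => ?_⟩
      by_cases hyB : y ∈ B
      · exact hB hbB hyB hyb.symm
      have hyA := (hor y).resolve_right hyB
      rcases hcomp a haA y hyA with h | h
      · have hsub : S.filter (F.Adj y) ⊆ S.filter (F.Adj a) := fun z hz => by
          rw [Finset.mem_filter] at hz ⊢
          exact ⟨hz.1, h hz.2⟩
        have heq := Finset.eq_of_subset_of_card_le hsub
          (hmin y (Finset.mem_filter.mpr ⟨hy, hyA⟩))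
        have : b ∈ S.filter (F.Adj y) := heq ▸ Finset.mem_filter.mpr ⟨hbS, hab⟩
        exact (Finset.mem_filter.mp this).2.symm
      · exact (h hab : F.Adj y b).symm
  · obtain ⟨x, hx⟩ := hS
    have hSB : ∀ y ∈ S, y ∈ B := fun y hy => (hor y).resolve_left fun hyA =>
      hSA ⟨y, Finset.mem_filter.mpr ⟨hy, hyA⟩⟩
    exact ⟨x, hx, .inr fun y hy hyx => hB (hSB x hx) (hSB y hy) hyx.symm⟩

/-- Isolated or dominating vertices are deleted one by one, and the word records their kinds. -/
theorem exists_word_of_isThresholdGraph {U : Type*} [Finite U] {F : SimpleGraph U}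
    (hF : IsThresholdGraph F) (W : Type*) : ∃ w : List Bool, ∀ (G : SimpleGraph W) (X : Set W),
      Contains G w X → ∃ f : F ↪g G, ∀ x, f x ∈ X := by
  classical
  -- Partial maps are used because `W` may have no element to serve as a default value outside `S`.
  have main : ∀ S : Finset U, ∃ w : List Bool, ∀ (G : SimpleGraph W) (X : Set W),
      Contains G w X → ∃ f : U → Option W, ∀ x ∈ S, ∃ a ∈ X, f x = some a ∧
        ∀ y ∈ S, ∀ b, f y = some b → (a = b → x = y) ∧ (G.Adj a b ↔ F.Adj x y) := by
    intro S
    induction S using Finset.strongInduction with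
    | H S ih =>
      rcases S.eq_empty_or_nonempty with rfl | hS
      · exact ⟨[], fun G X _ => ⟨fun _ => none, by simp⟩⟩
      obtain ⟨x, hx, hiso⟩ := exists_isolated_or_dominating hF S hS
      obtain ⟨w, hw⟩ := ih (S.erase x) (Finset.erase_ssubset hx)
      have extend : ∀ (G : SimpleGraph W) (X Y : Set W) (u : W), u ∈ X →
          (∀ z ∈ Y, z ∈ X ∧ z ≠ u ∧ ∀ y ∈ S.erase x, (G.Adj u z ↔ F.Adj x y)) →
          Contains G w Y → ∃ f : U → Option W, ∀ x ∈ S, ∃ a ∈ X, f x = some a ∧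
            ∀ y ∈ S, ∀ b, f y = some b → (a = b → x = y) ∧ (G.Adj a b ↔ F.Adj x y) := by
        intro G X Y u hu hY hc
        obtain ⟨f, hf⟩ := hw G Y hc
        refine ⟨Function.update f x (some u), fun y hy => ?_⟩
        by_cases hyx : y = x
        · subst hyx
          refine ⟨u, hu, by simp, fun z hz b hb => ?_⟩
          by_cases hzy : z = y
          · subst hzy
            simp at hb
            simp [hb]
          · rw [Function.update_of_ne hzy] at hb
            have hz' := Finset.mem_erase.mpr ⟨hzy, hz⟩
            obtain ⟨a, haY, ha, -⟩ := hf z hz'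
            obtain rfl : a = b := by simpa [ha] using hb
            exact ⟨fun h => absurd h.symm (hY a haY).2.1, (hY a haY).2.2 z hz'⟩
        · have hy' := Finset.mem_erase.mpr ⟨hyx, hy⟩
          obtain ⟨a, haY, ha, hrest⟩ := hf y hy'
          refine ⟨a, (hY a haY).1, by rw [Function.update_of_ne hyx, ha], fun z hz b hb => ?_⟩
          by_cases hzx : z = x
          · subst hzx
            obtain rfl : u = b := by simpa using hb
            refine ⟨fun h => absurd h (hY a haY).2.1, ?_⟩
            rw [G.adj_comm, F.adj_comm]
            exact (hY a haY).2.2 y hy'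
          · rw [Function.update_of_ne hzx] at hb
            exact hrest z (Finset.mem_erase.mpr ⟨hzx, hz⟩) b hb
      rcases hiso with hiso | hdom
      · refine ⟨false :: w, fun G X ⟨u, hu, hc⟩ => extend G X _ u hu (fun z hz => ?_) hc⟩
        exact ⟨hz.1, hz.2.1, fun y hy =>
          iff_of_false hz.2.2 (hiso y (Finset.mem_of_mem_erase hy))⟩
      · refine ⟨true :: w, fun G X ⟨u, hu, hc⟩ => extend G X _ u hu (fun z hz => ?_) hc⟩
        exact ⟨hz.1, hz.2.ne', fun y hy => iff_of_true hz.2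
          (hdom y (Finset.mem_of_mem_erase hy) (Finset.ne_of_mem_erase hy))⟩
  have := Fintype.ofFinite U
  obtain ⟨w, hw⟩ := main Finset.univ
  refine ⟨w, fun G X hc => ?_⟩
  obtain ⟨f, hf⟩ := hw G X hc
  choose g hgX hg hrest using fun x => hf x (Finset.mem_univ x)
  exact ⟨⟨⟨g, fun x y hxy => (hrest x y (Finset.mem_univ y) (g y) (hg y)).1 hxy⟩,
    fun {x y} => (hrest x y (Finset.mem_univ y) (g y) (hg y)).2⟩, hgX⟩

end PartialColoring

/-! ## List instances -/

namespace PartialColoring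

/-- A graph without induced paths on five vertices, with vertices among `0, …, n - 1`, and revenues.
A partial coloring is encoded as a map `φ : ℕ → ℕ`, with value `0` outside the domain and `c + 1` at
the vertices of color `c`. -/
structure Inst where
  n : ℕ
  G : SimpleGraph ℕ
  r : ℕ → ℕ → ℝ
  lt_of_adj : ∀ u v, G.Adj u v → u < n
  noInducedP5 : NoInducedP5 G

variable {H : SimpleGraph ℕ} {h : ℕ} {I : Inst} {L L' : ℕ → ℕ → Prop} {φ ψ : ℕ → ℕ}

theorem Inst.lt_of_adj' (I : Inst) {u v : ℕ} (huv : I.G.Adj u v) : v < I.n :=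
  I.lt_of_adj v u huv.symm

/-- `φ` is a partial `H`-coloring that uses only colors from the lists `L`. -/
def Valid (H : SimpleGraph ℕ) (I : Inst) (L : ℕ → ℕ → Prop) (φ : ℕ → ℕ) : Prop :=
  (∀ v < I.n, ∀ c, φ v = c + 1 → L v c) ∧
    ∀ u v a b, I.G.Adj u v → φ u = a + 1 → φ v = b + 1 → H.Adj a b

/-- The revenue of a vertex `v` for the code `x` of a color. -/
def gain (r : ℕ → ℕ → ℝ) (v x : ℕ) : ℝ := if x = 0 then 0 else r v (x - 1)

/-- The revenue of `φ`. -/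
noncomputable def total (I : Inst) (φ : ℕ → ℕ) : ℝ := ∑ v ∈ Finset.range I.n, gain I.r v (φ v)

/-- A valid coloring that is optimal if the instance is in the class `K`. -/
def Sol (H : SimpleGraph ℕ) (K : Inst → (ℕ → ℕ → Prop) → Prop) (I : Inst) (L : ℕ → ℕ → Prop)
    (φ : ℕ → ℕ) : Prop :=
  Valid H I L φ ∧ (K I L → ∀ ψ, Valid H I L ψ → total I ψ ≤ total I φ)

/-- The lists `L` on the vertices with property `P`, and empty lists elsewhere. -/
def restrict (P : ℕ → Prop) (L : ℕ → ℕ → Prop) : ℕ → ℕ → Prop := fun v c => P v ∧ L v c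

open Classical in
/-- The restriction of `φ` to the vertices with property `P`. -/
noncomputable def mask (P : ℕ → Prop) (φ : ℕ → ℕ) : ℕ → ℕ := fun v => if P v then φ v else 0

/-- The vertices with nonempty lists. -/
def supp (L : ℕ → ℕ → Prop) : Set ℕ := {v | ∃ c, L v c}

/-! ### Restricting colorings -/

theorem mask_eq_succ {P : ℕ → Prop} {v c : ℕ} : mask P φ v = c + 1 ↔ P v ∧ φ v = c + 1 := by
  unfold mask
  split_ifs with hv <;> simp [hv]

theorem Valid.mask (hφ : Valid H I L φ) (P : ℕ → Prop) :
    Valid H I (restrict P L) (mask P φ) :=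
  ⟨fun v hv c hc => ⟨(mask_eq_succ.mp hc).1, hφ.1 v hv c (mask_eq_succ.mp hc).2⟩,
    fun u v a b huv hu hv => hφ.2 u v a b huv (mask_eq_succ.mp hu).2 (mask_eq_succ.mp hv).2⟩

theorem Valid.congr (hφ : Valid H I L φ) (h : ∀ v < I.n, φ v = ψ v) : Valid H I L ψ :=
  ⟨fun v hv c hc => hφ.1 v hv c (h v hv ▸ hc), fun u v a b huv hu hv => hφ.2 u v a b huv
    (h u (I.lt_of_adj u v huv) ▸ hu) (h v (I.lt_of_adj' huv) ▸ hv)⟩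

theorem total_congr (h : ∀ v < I.n, φ v = ψ v) : total I φ = total I ψ :=
  Finset.sum_congr rfl fun v hv => by rw [h v (Finset.mem_range.mp hv)]

theorem Sol.congr {K : Inst → (ℕ → ℕ → Prop) → Prop} (hφ : Sol H K I L φ)
    (h : ∀ v < I.n, φ v = ψ v) : Sol H K I L ψ :=
  ⟨hφ.1.congr h, fun hK ξ hξ => (hφ.2 hK ξ hξ).trans_eq (total_congr h)⟩

theorem valid_zero (hφ : ∀ v < I.n, φ v = 0) : Valid H I L φ :=
  ⟨fun v hv c hc => by simp [hφ v hv] at hc, fun u v a b huv hu _ => by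
    simp [hφ u (I.lt_of_adj u v huv)] at hu⟩

theorem total_zero (hφ : ∀ v < I.n, φ v = 0) : total I φ = 0 :=
  Finset.sum_eq_zero fun v hv => by simp [gain, hφ v (Finset.mem_range.mp hv)]

theorem Valid.eq_zero (hφ : Valid H I L φ) {v : ℕ} (hv : v < I.n) (h : v ∉ supp L) : φ v = 0 := by
  by_contra h0
  obtain ⟨c, hc⟩ := Nat.exists_eq_succ_of_ne_zero h0
  exact h ⟨c, hφ.1 v hv c hc⟩

/-! ### Separating the neighborhood of a vertex -/

/-- The lists that remain if `u` has the color `a` (no color if `a` is not below `h`) and the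
neighbors `p j` and `q j` of `u`, of color `j`, dominate everything outside of the closed
neighborhood of `u` that neighbors of `u` of color `j` dominate. -/
def prune (H : SimpleGraph ℕ) (h : ℕ) (G : SimpleGraph ℕ) (u a : ℕ) (p q : ℕ → ℕ)
    (L : ℕ → ℕ → Prop) : ℕ → ℕ → Prop := fun v c =>
  L v c ∧ (v = u → c = a) ∧
    (G.Adj u v → (a < h → H.Adj a c) ∧
      ∀ z, z ≠ u → ¬ G.Adj u z → G.Adj v z → G.Adj (p c) z ∨ G.Adj (q c) z) ∧
    (v ≠ u → ¬ G.Adj u v → ∀ j < h, G.Adj (p j) v ∨ G.Adj (q j) v → H.Adj j c)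

open Classical in
/-- Colorings of the neighborhood of `u` and of the non-neighbors of `u` are put together, and `u`
gets the color `a` if it is in the list of `u`. -/
noncomputable def combine (G : SimpleGraph ℕ) (u a : ℕ) (L : ℕ → ℕ → Prop) (φ ψ : ℕ → ℕ) :
    ℕ → ℕ := fun v =>
  if G.Adj u v then φ v else if v = u then (if L u a then a + 1 else 0) else ψ v

/-- The parameters are arbitrary: `p j` and `q j` need be neither neighbors of `u` nor of color `j`.
Wrong guesses are therefore harmless. -/
theorem Valid.combine {u a : ℕ} {p q : ℕ → ℕ} (hL : ∀ v c, L v c → c < h)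
    (hφ : Valid H I (restrict (I.G.Adj u) (prune H h I.G u a p q L)) φ)
    (hψ : Valid H I (restrict (fun v => v ≠ u ∧ ¬ I.G.Adj u v) (prune H h I.G u a p q L)) ψ) :
    Valid H I L (combine I.G u a (prune H h I.G u a p q L) φ ψ) := by
  have hcol : ∀ v < I.n, ∀ c, PartialColoring.combine I.G u a (prune H h I.G u a p q L) φ ψ v =
      c + 1 → prune H h I.G u a p q L v c := by
    intro v hv c hc
    unfold PartialColoring.combine at hc
    split_ifs at hc with h1 h2 h3
    · exact (hφ.1 v hv c hc).2
    · subst h2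
      obtain rfl : a = c := by omega
      exact h3
    · exact (hψ.1 v hv c hc).2
  refine ⟨fun v hv c hc => (hcol v hv c hc).1, ?_⟩
  have cross : ∀ v w b c, I.G.Adj v w → I.G.Adj u v → ¬ I.G.Adj u w →
      PartialColoring.combine I.G u a (prune H h I.G u a p q L) φ ψ v = b + 1 →
      PartialColoring.combine I.G u a (prune H h I.G u a p q L) φ ψ w = c + 1 → H.Adj b c := by
    intro v w b c hvw huv huw hv hw
    have pv := hcol v (I.lt_of_adj v w hvw) b hv
    have pw := hcol w (I.lt_of_adj' hvw) c hw
    by_cases hwu : w = u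
    · subst hwu
      obtain rfl := pw.2.1 rfl
      exact ((pv.2.2.1 huv).1 (hL _ _ pw.1)).symm
    -- The pruned list of `v` says that `w` is adjacent to `p b` or `q b`, so the pruned list of `w`
    -- has only colors compatible with `b`.
    · exact pw.2.2.2 hwu huw b (hL _ _ pv.1) ((pv.2.2.1 huv).2 w hwu huw hvw)
  intro v w b c hvw hv hw
  by_cases huv : I.G.Adj u v <;> by_cases huw : I.G.Adj u w
  · rw [PartialColoring.combine, if_pos huv] at hv
    rw [PartialColoring.combine, if_pos huw] at hw
    exact hφ.2 v w b c hvw hv hw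
  · exact cross v w b c hvw huv huw hv hw
  · exact (cross w v c b hvw.symm huw huv hw hv).symm
  · have hvu : v ≠ u := fun e => huw (e ▸ hvw)
    have hwu : w ≠ u := fun e => huv (e ▸ hvw.symm)
    rw [PartialColoring.combine, if_neg huv, if_neg hvu] at hv
    rw [PartialColoring.combine, if_neg huw, if_neg hwu] at hw
    exact hψ.2 v w b c hvw hv hw

/-- Every valid coloring obeys the pruned lists for some choice of the parameters. -/
theorem Valid.exists_prune (hψ : Valid H I L ψ) (hL : ∀ v c, L v c → c < h) {u : ℕ}
    (hu : u < I.n) : ∃ a ≤ h, ∃ p q : ℕ → ℕ, (∀ j, p j ≤ I.n) ∧ (∀ j, q j ≤ I.n) ∧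
      (∀ c, ψ u = c + 1 → a = c) ∧ (a < h → ψ u = a + 1) ∧ Valid H I (prune H h I.G u a p q L) ψ := by
  classical
  have hpq : ∀ j, ∃ p ≤ I.n, ∃ q ≤ I.n,
      (∀ x, x = p ∨ x = q → ∀ z, I.G.Adj x z → ψ x = j + 1) ∧
      ∀ w, I.G.Adj u w → ψ w = j + 1 → ∀ z, ¬ I.G.Adj u z → I.G.Adj w z →
        I.G.Adj p z ∨ I.G.Adj q z := by
    intro j
    let A := (Finset.range I.n).filter fun v => I.G.Adj u v ∧ ψ v = j + 1
    have hA : ∀ v, v ∈ A ↔ v < I.n ∧ I.G.Adj u v ∧ ψ v = j + 1 := by simp [A]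
    by_cases hne : A.Nonempty
    · obtain ⟨p, hp, q, hq, hc⟩ := exists_pair_cover I.noInducedP5 u A hne
        (fun v hv => ((hA v).mp hv).2.1) (fun v hv w hw hvw =>
          (hψ.2 v w j j hvw ((hA v).mp hv).2.2 ((hA w).mp hw).2.2).ne rfl)
      refine ⟨p, ((hA p).mp hp).1.le, q, ((hA q).mp hq).1.le, ?_, fun w huw hw =>
        hc w ((hA w).mpr ⟨I.lt_of_adj' huw, huw, hw⟩)⟩
      rintro x (rfl | rfl) z -
      · exact ((hA _).mp hp).2.2
      · exact ((hA _).mp hq).2.2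
    -- The number `n` is not a vertex and has no neighbors: it is the dummy for a color that does
    -- not occur in the neighborhood of `u`.
    · refine ⟨I.n, le_rfl, I.n, le_rfl, ?_, fun w huw hw =>
        absurd ⟨w, (hA w).mpr ⟨I.lt_of_adj' huw, huw, hw⟩⟩ hne⟩
      rintro x (rfl | rfl) z hz <;> exact absurd (I.lt_of_adj _ _ hz) (lt_irrefl _)
  choose p hp q hq hc hcov using hpq
  obtain ⟨a, ha, hau⟩ : ∃ a ≤ h, (∀ c, ψ u = c + 1 → a = c) ∧ (a < h → ψ u = a + 1) := by
    rcases Nat.eq_zero_or_eq_succ_pred (ψ u) with h0 | h0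
    · exact ⟨h, le_rfl, fun c hc => by omega, fun hh => absurd hh (lt_irrefl _)⟩
    · exact ⟨_, (hL _ _ (hψ.1 u hu _ h0)).le, fun c hc => by omega, fun _ => h0⟩
  refine ⟨a, ha, p, q, hp, hq, hau.1, hau.2, fun v hv c hvc => ⟨hψ.1 v hv c hvc, ?_, ?_, ?_⟩, hψ.2⟩
  · rintro rfl
    exact (hau.1 c hvc).symm
  · exact fun huv => ⟨fun hah => hψ.2 u v a c huv (hau.2 hah) hvc,
      fun z _ huz hvz => hcov c v huv hvc z huz hvz⟩
  · rintro - - j - (hj | hj)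
    · exact hψ.2 _ _ j c hj (hc j _ (.inl rfl) _ hj) hvc
    · exact hψ.2 _ _ j c hj (hc j _ (.inr rfl) _ hj) hvc

theorem total_eq_add_mask (I : Inst) (P : ℕ → Prop) (φ : ℕ → ℕ) :
    total I φ = total I (mask P φ) + total I (mask (fun v => ¬ P v) φ) := by
  classical
  unfold total
  rw [← Finset.sum_add_distrib]
  refine Finset.sum_congr rfl fun v _ => ?_
  by_cases hv : P v <;> simp [mask, hv, gain]

/-- The instances on which colorings of the neighborhood of a suitable vertex and of its
non-neighbors can be found separately. -/
def StepClass (H : SimpleGraph ℕ) (KA KB : Inst → (ℕ → ℕ → Prop) → Prop) (I : Inst)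
    (L : ℕ → ℕ → Prop) : Prop :=
  ∀ ψ, Valid H I L ψ → (∃ v < I.n, ψ v ≠ 0) → ∃ u < I.n, ∀ L' : ℕ → ℕ → Prop,
    (∀ v c, L' v c → L v c) → (∀ v c, I.G.Adj u v → L' v c → ψ u ≠ c + 1) →
    KA I (restrict (I.G.Adj u) L') ∧ KB I (restrict (fun v => v ≠ u ∧ ¬ I.G.Adj u v) L')

/-- With the right guess `ψ` obeys the pruned lists. Its restrictions then compete with `φA` and
`φB`, and at `u` it agrees with the combined coloring. -/
theorem StepClass.exists_params {KA KB : Inst → (ℕ → ℕ → Prop) → Prop}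
    (hK : StepClass H KA KB I L) (hL : ∀ v c, L v c → c < h) (hψ : Valid H I L ψ)
    (hne : ∃ v < I.n, ψ v ≠ 0) : ∃ u < I.n, ∃ a ≤ h, ∃ p q : ℕ → ℕ, (∀ j, p j ≤ I.n) ∧
      (∀ j, q j ≤ I.n) ∧ ∀ φA φB,
      Sol H KA I (restrict (I.G.Adj u) (prune H h I.G u a p q L)) φA →
      Sol H KB I (restrict (fun v => v ≠ u ∧ ¬ I.G.Adj u v) (prune H h I.G u a p q L)) φB →
      total I ψ ≤ total I (combine I.G u a (prune H h I.G u a p q L) φA φB) := by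
  obtain ⟨u, hu, hK⟩ := hK ψ hψ hne
  obtain ⟨a, ha, p, q, hp, hq, hau, hah, hv⟩ := hψ.exists_prune hL hu
  refine ⟨u, hu, a, ha, p, q, hp, hq, fun φA φB hA hB => ?_⟩
  obtain ⟨kA, kB⟩ := hK (prune H h I.G u a p q L) (fun v c hc => hc.1) (by
    intro v c huv hvc hc
    obtain rfl := hau c hc
    exact ((hvc.2.2.1 huv).1 (hL _ _ hvc.1)).ne rfl)
  have tA := hA.2 kA _ (hv.mask _)
  have tB := hB.2 kB _ (hv.mask _)
  set C := combine I.G u a (prune H h I.G u a p q L) φA φB with hC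
  have hR : ∀ ξ : ℕ → ℕ, total I ξ = total I (mask (I.G.Adj u) ξ) +
      (total I (mask (fun v => v ≠ u ∧ ¬ I.G.Adj u v) ξ) + total I (mask (· = u) ξ)) := by
    intro ξ
    rw [total_eq_add_mask I (I.G.Adj u) ξ,
      total_eq_add_mask I (· ≠ u) (mask (fun v => ¬ I.G.Adj u v) ξ)]
    congr 2
    · congr 1
      ext v
      by_cases hv : v = u <;> by_cases huv : I.G.Adj u v <;> simp [mask, hv, huv]
    · congr 1
      ext v
      by_cases hv : v = u <;> simp [mask, hv]
  have e1 : total I (mask (I.G.Adj u) C) = total I φA := by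
    refine total_congr fun v hv => ?_
    by_cases huv : I.G.Adj u v
    · simp [mask, huv, hC, combine]
    · simp only [mask, huv, if_false]
      exact (hA.1.eq_zero hv fun ⟨c, hc⟩ => huv hc.1).symm
  have e2 : total I (mask (fun v => v ≠ u ∧ ¬ I.G.Adj u v) C) = total I φB := by
    refine total_congr fun v hv => ?_
    by_cases huv : v ≠ u ∧ ¬ I.G.Adj u v
    · simp [mask, huv, hC, combine]
    · simp only [mask, huv, if_false]
      exact (hB.1.eq_zero hv fun ⟨c, hc⟩ => huv hc.1).symm
  have e3 : total I (mask (· = u) C) = total I (mask (· = u) ψ) := by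
    refine total_congr fun v _ => ?_
    by_cases hvu : v = u
    · subst hvu
      simp only [mask, if_true, hC, combine, SimpleGraph.irrefl, if_false]
      rcases Nat.eq_zero_or_eq_succ_pred (ψ v) with h0 | h0
      · have : ¬ prune H h I.G v a p q L v a := fun hpa => by
          have := hah (hL _ _ hpa.1)
          omega
        simp [this, h0]
      · have := hau _ h0
        have h2 := hv.1 v hu _ h0
        rw [← this] at h2
        rw [if_pos h2, h0, ← this]
    · simp [mask, hvu]
  rw [hR ψ, hR C, e1, e2, e3]
  linarith

/-! ### Components -/

/-- The lists of the component of `r`. -/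
def component (G : SimpleGraph ℕ) (L : ℕ → ℕ → Prop) (r : ℕ) : ℕ → ℕ → Prop :=
  restrict (fun v => Link G (supp L) r v) L

/-- The instances with all components in `K`. -/
def ComponentsIn (K : Inst → (ℕ → ℕ → Prop) → Prop) (I : Inst) (L : ℕ → ℕ → Prop) : Prop :=
  ∀ r ∈ supp L, K I (component I.G L r)

/-- `P` is only a partial equivalence relation. The vertices not related to themselves share the
empty class and are compared one by one. -/
theorem sum_le_sum_of_classes {n : ℕ} (P : ℕ → ℕ → Prop) (symm : ∀ a b, P a b → P b a)
    (trans : ∀ a b c, P a b → P b c → P a c) (f g : ℕ → ℝ)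
    (hz : ∀ v < n, ¬ P v v → f v ≤ g v) [∀ a b, Decidable (P a b)]
    (hfg : ∀ r < n, P r r → ∑ v ∈ (Finset.range n).filter (P r), f v ≤
      ∑ v ∈ (Finset.range n).filter (P r), g v) :
    ∑ v ∈ Finset.range n, f v ≤ ∑ v ∈ Finset.range n, g v := by
  let key : ℕ → Finset ℕ := fun v => (Finset.range n).filter (P v)
  have hkey : ∀ v ∈ Finset.range n, key v ∈ (Finset.range n).image key := fun v hv =>
    Finset.mem_image_of_mem _ hv
  rw [← Finset.sum_fiberwise_of_maps_to hkey f, ← Finset.sum_fiberwise_of_maps_to hkey g]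
  refine Finset.sum_le_sum fun b hb => ?_
  obtain ⟨r, hr, rfl⟩ := Finset.mem_image.mp hb
  have hrn := Finset.mem_range.mp hr
  by_cases hrr : P r r
  · have : (Finset.range n).filter (fun v => key v = key r) = (Finset.range n).filter (P r) := by
      refine Finset.filter_congr fun v hv => ⟨fun he => ?_, fun hrv => ?_⟩
      · have : r ∈ key v := he ▸ Finset.mem_filter.mpr ⟨hr, hrr⟩
        exact symm _ _ (Finset.mem_filter.mp this).2
      · refine Finset.filter_congr fun w _ => ⟨fun h => trans _ _ _ hrv h, fun h =>
          trans _ _ _ (symm _ _ hrv) h⟩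
    rw [this]
    exact hfg r hrn hrr
  · refine Finset.sum_le_sum fun v hv => ?_
    obtain ⟨hv, he⟩ := Finset.mem_filter.mp hv
    refine hz v (Finset.mem_range.mp hv) fun hvv => hrr ?_
    have : v ∈ key r := he ▸ Finset.mem_filter.mpr ⟨hv, hvv⟩
    have := (Finset.mem_filter.mp this).2
    exact trans _ _ _ this (symm _ _ this)

/-- Solutions of the components form a solution. -/
theorem Sol.of_components {K : Inst → (ℕ → ℕ → Prop) → Prop}
    (hcomp : ∀ r < I.n, Sol H K I (component I.G L r) (mask (fun v => Link I.G (supp L) r v) φ))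
    (hφ : ∀ v < I.n, φ v ≠ 0 → v ∈ supp L) : Sol H (ComponentsIn K) I L φ := by
  classical
  have self : ∀ v < I.n, ∀ c, φ v = c + 1 → Link I.G (supp L) v v := fun v hv c hc =>
    .refl (hφ v hv (by omega))
  refine ⟨⟨fun v hv c hc => ?_, fun u v a b huv hu hv => ?_⟩, fun hK ψ hψ => ?_⟩
  · exact ((hcomp v hv).1.1 v hv c (mask_eq_succ.mpr ⟨self v hv c hc, hc⟩)).2
  · have hun := I.lt_of_adj u v huv
    have hvn := I.lt_of_adj' huv
    refine (hcomp u hun).1.2 u v a b huv (mask_eq_succ.mpr ⟨self u hun a hu, hu⟩)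
      (mask_eq_succ.mpr ⟨?_, hv⟩)
    exact (self u hun a hu).step I.noInducedP5 (self v hvn b hv).1 (.inr huv)
  · refine sum_le_sum_of_classes (Link I.G (supp L)) (fun _ _ h => h.symm)
      (fun _ _ _ h => h.trans I.noInducedP5) _ _ (fun v hv hvv => ?_) (fun r hr hrr => ?_)
    · have hvs : v ∉ supp L := fun h => hvv (.refl h)
      have h0 : φ v = 0 := by
        by_contra h0
        exact hvs (hφ v hv h0)
      rw [hψ.eq_zero hv hvs, h0]
    · have := (hcomp r hr).2 (hK r hrr.1) _ (hψ.mask _)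
      simp only [total, mask] at this
      have e : ∀ ξ : ℕ → ℕ, ∑ v ∈ Finset.range I.n,
          gain I.r v (if Link I.G (supp L) r v then ξ v else 0) =
          ∑ v ∈ (Finset.range I.n).filter (Link I.G (supp L) r), gain I.r v (ξ v) := by
        intro ξ
        rw [Finset.sum_filter]
        refine Finset.sum_congr rfl fun v _ => ?_
        split_ifs <;> simp [gain]
      rwa [e, e] at this

end PartialColoring

/-! ## Reasoning about programs -/

namespace RealRAM

/-- The state after the integer variable `x` is set to `v`. -/
def State.setI (s : State) (x v : ℕ) : State := { s with ivar := Function.update s.ivar x v }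

@[simp] theorem State.setI_ivar_self (s : State) (x v : ℕ) : (s.setI x v).ivar x = v := by
  simp [State.setI]

theorem State.setI_ivar_of_ne (s : State) {x y : ℕ} (v : ℕ) (h : y ≠ x) :
    (s.setI x v).ivar y = s.ivar y := by
  simp [State.setI, h]

@[simp] theorem State.setI_rvar (s : State) (x v : ℕ) : (s.setI x v).rvar = s.rvar := rfl
@[simp] theorem State.setI_iarr (s : State) (x v : ℕ) : (s.setI x v).iarr = s.iarr := rfl

/-- The program `p` halts in polynomially many steps from every state, keeps the integer variable
`0`, and relates the initial and the final state by `Q`. -/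
def Tri (p : Prog) (Q : State → State → Prop) : Prop :=
  ∃ T : Polynomial ℕ, ∀ s, ∃ s' t, Runs p s s' t ∧ t ≤ T.eval (s.ivar 0) ∧
    s'.ivar 0 = s.ivar 0 ∧ Q s s'

variable {p q : Prog} {Q R : State → State → Prop}

theorem Tri.mono (hp : Tri p Q) (h : ∀ s s', s'.ivar 0 = s.ivar 0 → Q s s' → R s s') :
    Tri p R := by
  obtain ⟨T, hT⟩ := hp
  refine ⟨T, fun s => ?_⟩
  obtain ⟨s', t, h1, h2, h3, h4⟩ := hT s
  exact ⟨s', t, h1, h2, h3, h s s' h3 h4⟩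

theorem Tri.skip : Tri .skip fun s s' => s' = s :=
  ⟨1, fun s => ⟨s, 1, .skip s, by simp, rfl, rfl⟩⟩

theorem Tri.setI {x : ℕ} (hx : x ≠ 0) (e : IExp) :
    Tri (.setI x e) fun s s' => s' = s.setI x (e.eval s) :=
  ⟨Polynomial.C (e.cost + 1), fun s =>
    ⟨_, _, .setI s x e, by simp, s.setI_ivar_of_ne _ hx.symm, rfl⟩⟩

theorem Tri.setR (x : ℕ) (e : RExp) : Tri (.setR x e) fun s s' =>
    s' = { s with rvar := Function.update s.rvar x (e.eval s) } :=
  ⟨Polynomial.C (e.cost + 1), fun s => ⟨_, _, .setR s x e, by simp, rfl, rfl⟩⟩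

theorem Tri.writeI (k : ℕ) (i j e : IExp) : Tri (.writeI k i j e) fun s s' =>
    s' = { s with iarr := update3 s.iarr k (i.eval s) (j.eval s) (e.eval s) } :=
  ⟨Polynomial.C (i.cost + j.cost + e.cost + 1), fun s =>
    ⟨_, _, .writeI s k i j e, by simp, rfl, rfl⟩⟩

theorem Tri.seq (hp : Tri p Q) (hq : Tri q R) :
    Tri (.seq p q) fun s s'' => ∃ s', s'.ivar 0 = s.ivar 0 ∧ Q s s' ∧ R s' s'' := by
  obtain ⟨T, hT⟩ := hp
  obtain ⟨U, hU⟩ := hq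
  refine ⟨T + U, fun s => ?_⟩
  obtain ⟨s', t, h1, h2, h3, h4⟩ := hT s
  obtain ⟨s'', u, g1, g2, g3, g4⟩ := hU s'
  refine ⟨s'', t + u, .seq h1 g1, ?_, g3.trans h3, s', h3, h4, g4⟩
  rw [h3] at g2
  simpa using Nat.add_le_add h2 g2

theorem Tri.cond (b : Test) (hp : Tri p Q) (hq : Tri q R) :
    Tri (.cond b p q) fun s s' => (b.holds s ∧ Q s s') ∨ (¬ b.holds s ∧ R s s') := by
  obtain ⟨T, hT⟩ := hp
  obtain ⟨U, hU⟩ := hq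
  refine ⟨Polynomial.C b.cost + T + U, fun s => ?_⟩
  by_cases hb : b.holds s
  · obtain ⟨s', t, h1, h2, h3, h4⟩ := hT s
    refine ⟨s', _, .condTrue hb h1, ?_, h3, .inl ⟨hb, h4⟩⟩
    simp only [Polynomial.eval_add, Polynomial.eval_C]
    omega
  · obtain ⟨s', t, h1, h2, h3, h4⟩ := hU s
    refine ⟨s', _, .condFalse hb h1, ?_, h3, .inr ⟨hb, h4⟩⟩
    simp only [Polynomial.eval_add, Polynomial.eval_C]
    omega

/-- A loop that is run at most `N` times. -/
theorem exists_runs_loop (b : Test) (p : Prog) (Inv : ℕ → State → Prop) (N T : ℕ)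
    (hstep : ∀ k s, Inv k s → b.holds s →
      k < N ∧ ∃ s' t, Runs p s s' t ∧ t ≤ T ∧ Inv (k + 1) s') (s : State) (hs : Inv 0 s) :
    ∃ k s' t, Runs (.loop b p) s s' t ∧ t ≤ N * (T + b.cost) + b.cost ∧ Inv k s' ∧
      ¬ b.holds s' := by
  have main : ∀ d k s, Inv k s → k + d = N → ∃ k s' t, Runs (.loop b p) s s' t ∧
      t ≤ d * (T + b.cost) + b.cost ∧ Inv k s' ∧ ¬ b.holds s' := by
    intro d
    induction d with
    | zero =>
      intro k s hk hN
      have hb : ¬ b.holds s := fun hb => by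
        have := (hstep k s hk hb).1
        omega
      exact ⟨k, s, _, .loopDone hb, by simp, hk, hb⟩
    | succ d ih =>
      intro k s hk hN
      by_cases hb : b.holds s
      · obtain ⟨-, s', t, h1, h2, h3⟩ := hstep k s hk hb
        obtain ⟨k', s'', t', g1, g2, g3⟩ := ih (k + 1) s' h3 (by omega)
        refine ⟨k', s'', _, .loopStep hb h1 g1, ?_, g3⟩
        rw [Nat.succ_mul]
        omega
      · exact ⟨k, s, _, .loopDone hb, by omega, hk, hb⟩
  exact main N 0 s hs (by omega)

/-- The test `x < n + b`. -/
def ltBound (b x : ℕ) : Test := .neg (.ile (.add (.var 0) (.const b)) (.var x))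

theorem ltBound_holds {b x : ℕ} {s : State} : (ltBound b x).holds s ↔ s.ivar x < s.ivar 0 + b := by
  simp [ltBound, Test.holds, IExp.eval]

/-- The program `x := x + 1`. -/
def incr (x : ℕ) : Prog := .setI x (.add (.var x) (.const 1))

/-- The program `for x = 0, …, n + b - 1 do p`. -/
def forN (b x : ℕ) (p : Prog) : Prog :=
  .seq (.setI x (.const 0)) (.loop (ltBound b x) (.seq p (incr x)))

/-- The invariant refers to the state before the loop, which turns it into an input-output relation.
The body has to preserve the loop variable. -/
theorem Tri.forN {b x : ℕ} (hx : x ≠ 0) (hp : Tri p Q) (Inv : State → ℕ → State → Prop)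
    (h0 : ∀ s, Inv s 0 (s.setI x 0))
    (hstep : ∀ s₀ k s s', k < s₀.ivar 0 + b → s.ivar 0 = s₀.ivar 0 → s.ivar x = k → Inv s₀ k s →
      s'.ivar 0 = s.ivar 0 → Q s s' → s'.ivar x = k ∧ Inv s₀ (k + 1) (s'.setI x (k + 1))) :
    Tri (forN b x p) fun s s' => Inv s (s.ivar 0 + b) s' := by
  obtain ⟨T, hT⟩ := hp.seq (Tri.setI hx (.add (.var x) (.const 1)))
  refine ⟨(Polynomial.X + Polynomial.C b) * (T + Polynomial.C (ltBound b x).cost) +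
    -- The summand `2` pays for setting the loop variable to `0`.
    Polynomial.C (ltBound b x).cost + 2, fun s => ?_⟩
  obtain ⟨k, s', t, h1, h2, ⟨h3, h4, h5, h6⟩, h7⟩ := exists_runs_loop (ltBound b x)
    (.seq p (incr x)) (fun k s' => k ≤ s.ivar 0 + b ∧ s'.ivar x = k ∧ s'.ivar 0 = s.ivar 0 ∧
      Inv s k s') (s.ivar 0 + b) (T.eval (s.ivar 0)) (by
        rintro k s₁ ⟨h1, h2, h3, h4⟩ hb
        rw [ltBound_holds, h2, h3] at hb
        obtain ⟨s₂, t, g1, g2, g3, s₃, g4, g5, g6⟩ := hT s₁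
        obtain ⟨g7, g8⟩ := hstep s k s₁ s₃ hb h3 h2 h4 g4 g5
        rw [h3] at g2 g3
        have e : (IExp.add (.var x) (.const 1)).eval s₃ = k + 1 := by simp [IExp.eval, g7]
        rw [e] at g6
        subst g6
        exact ⟨hb, _, t, g1, g2, hb, by simp, g3, g8⟩)
    (s.setI x 0) ⟨by simp, by simp, s.setI_ivar_of_ne _ hx.symm, h0 s⟩
  rw [ltBound_holds, h4, h5] at h7
  obtain rfl : k = s.ivar 0 + b := by omega
  refine ⟨s', _, .seq (.setI s x (.const 0)) h1, ?_, h5, h6⟩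
  simp only [IExp.cost, Polynomial.eval_add, Polynomial.eval_mul, Polynomial.eval_X,
    Polynomial.eval_C, Polynomial.eval_ofNat]
  omega

/-! ### Frames -/

/-- The memory with names below `m` is the same in both states. -/
def Agree (m : ℕ) (s s' : State) : Prop := ∀ k < m, s'.ivar k = s.ivar k ∧ s'.rvar k = s.rvar k ∧
  s'.iarr k = s.iarr k ∧ s'.rarr k = s.rarr k

theorem Agree.trans {m : ℕ} {s s' s'' : State} (h : Agree m s s') (h' : Agree m s' s'') :
    Agree m s s'' := fun k hk =>
  ⟨(h' k hk).1.trans (h k hk).1, (h' k hk).2.1.trans (h k hk).2.1,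
    (h' k hk).2.2.1.trans (h k hk).2.2.1, (h' k hk).2.2.2.trans (h k hk).2.2.2⟩

theorem Agree.mono {m m' : ℕ} {s s' : State} (h : Agree m s s') (hm : m' ≤ m) : Agree m' s s' :=
  fun k hk => h k (hk.trans_le hm)

theorem Agree.refl (m : ℕ) (s : State) : Agree m s s := fun _ _ => ⟨rfl, rfl, rfl, rfl⟩

theorem Agree.setI {m : ℕ} {s s' : State} (h : Agree m s s') {x : ℕ} (hx : m ≤ x) (v : ℕ) :
    Agree m s (s'.setI x v) := fun k hk =>
  ⟨(s'.setI_ivar_of_ne v (by omega)).trans (h k hk).1, (h k hk).2⟩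

/-- Nothing but integer variables with names from `m` on and the integer array `k` changes. -/
structure Upd (m k : ℕ) (s s' : State) : Prop where
  ivar : ∀ x < m, s'.ivar x = s.ivar x
  rvar : s'.rvar = s.rvar
  iarr : ∀ k', k' ≠ k → s'.iarr k' = s.iarr k'
  rarr : s'.rarr = s.rarr

theorem Upd.agree {m k m' : ℕ} {s s' : State} (h : Upd m k s s') (hm : m' ≤ m) (hk : m' ≤ k) :
    Agree m' s s' := fun x hx =>
  ⟨h.ivar x (by omega), by rw [h.rvar], h.iarr x (by omega), by rw [h.rarr]⟩

/-! ### Formulas with bounded quantifiers -/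

/-- First-order formulas over the memory. Quantifiers range over the numbers below `n + b`; at the
level `m` they bind the integer variable `m`, and their scope is at the level `m + 1`. -/
inductive Fm : Type
  | test (t : Test)
  | neg (f : Fm)
  | and (f g : Fm)
  | ex (f : Fm)

namespace Fm

/-- The truth of a formula at the level `m`. -/
def holds (b : ℕ) : ℕ → State → Fm → Prop
  | _, s, .test t => t.holds s
  | m, s, .neg f => ¬ f.holds b m s
  | m, s, .and f g => f.holds b m s ∧ g.holds b m s
  | m, s, .ex f => ∃ k < s.ivar 0 + b, f.holds b (m + 1) (s.setI m k)

/-- A program that evaluates a formula at the level `m`, with the result in the variable `m`. -/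
def compile (b : ℕ) : ℕ → Fm → Prog
  | m, .test t => .cond t (.setI m (.const 1)) (.setI m (.const 0))
  | m, .neg f => .seq (f.compile b m)
      (.cond (.ile (.const 1) (.var m)) (.setI m (.const 0)) (.setI m (.const 1)))
  | m, .and f g => .seq (f.compile b m) (.cond (.ile (.const 1) (.var m)) (g.compile b m) .skip)
  | m, .ex f => .seq (.seq (.setI (m + 1) (.const 0)) (.setI m (.const 0)))
      (.seq (.loop (.and (ltBound b m) (.ile (.var (m + 1)) (.const 0)))
        (.seq (f.compile b (m + 1)) (incr m))) (.setI m (.var (m + 1))))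

end Fm

/-- The expression depends on integer variables with names below `m` only, and on integer arrays
other than `k`. -/
def IExp.Below (m k : ℕ) : IExp → Prop
  | .const _ => True
  | .var x => x < m
  | .read k' i j => k' ≠ k ∧ i.Below m k ∧ j.Below m k
  | .add a b => a.Below m k ∧ b.Below m k
  | .sub a b => a.Below m k ∧ b.Below m k

/-- The test depends on integer variables with names below `m` only, and on integer arrays other
than `k`. -/
def Test.Below (m k : ℕ) : Test → Prop
  | .ile a b => a.Below m k ∧ b.Below m k
  | .rle _ _ => False
  | .neg t => t.Below m k
  | .and t u => t.Below m k ∧ u.Below m k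

/-- The formula at the level `m` depends on integer variables with names below `m` only, and on
integer arrays other than `k`. -/
def Fm.Below (k : ℕ) : ℕ → Fm → Prop
  | m, .test t => t.Below m k
  | m, .neg f => f.Below k m
  | m, .and f g => f.Below k m ∧ g.Below k m
  | m, .ex f => f.Below k (m + 1)

theorem IExp.eval_congr {m k : ℕ} {s s' : State} (ha : ∀ k' ≠ k, s'.iarr k' = s.iarr k')
    (hv : ∀ x < m, s'.ivar x = s.ivar x) {e : IExp} (he : e.Below m k) :
    e.eval s' = e.eval s := by
  induction e with
  | const => rfl
  | var x => exact hv x he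
  | read k i j hi hj => simp only [IExp.eval, hi he.2.1, hj he.2.2, ha k he.1]
  | add a b hi hj => simp only [IExp.eval, hi he.1, hj he.2]
  | sub a b hi hj => simp only [IExp.eval, hi he.1, hj he.2]

theorem Test.holds_congr {m k : ℕ} {s s' : State} (ha : ∀ k' ≠ k, s'.iarr k' = s.iarr k')
    (hv : ∀ x < m, s'.ivar x = s.ivar x) {t : Test} (ht : t.Below m k) :
    t.holds s' ↔ t.holds s := by
  induction t with
  | ile a b => simp only [Test.holds, IExp.eval_congr ha hv ht.1, IExp.eval_congr ha hv ht.2]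
  | rle => exact ht.elim
  | neg t ih => simp only [Test.holds, ih ht]
  | and t u ih ih' => simp only [Test.holds, ih ht.1, ih' ht.2]

/-- `m ≠ 0` prevents quantifiers from binding the variable `0`, which determines their range. -/
theorem Fm.holds_congr {b m k : ℕ} (hm : m ≠ 0) {s s' : State}
    (ha : ∀ k' ≠ k, s'.iarr k' = s.iarr k')
    (hv : ∀ x < m, s'.ivar x = s.ivar x) {f : Fm} (hf : f.Below k m) :
    f.holds b m s' ↔ f.holds b m s := by
  induction f generalizing m s s' with
  | test t => exact Test.holds_congr ha hv hf
  | neg f ih => exact not_congr (ih hm ha hv hf)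
  | and f g ih ih' => exact and_congr (ih hm ha hv hf.1) (ih' hm ha hv hf.2)
  | ex f ih =>
    simp only [Fm.holds, hv 0 (Nat.pos_of_ne_zero hm)]
    refine exists_congr fun k => and_congr_right fun _ => ih (by omega) (by simpa) ?_ hf
    intro x hx
    by_cases hxm : x = m
    · simp [hxm]
    · rw [State.setI_ivar_of_ne _ _ hxm, State.setI_ivar_of_ne _ _ hxm]
      exact hv x (by omega)

/-! ### Evaluating formulas -/

/-- Nothing but integer variables with names from `m` on changes. -/
structure Scratch (m : ℕ) (s s' : State) : Prop where
  ivar : ∀ x < m, s'.ivar x = s.ivar x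
  rvar : s'.rvar = s.rvar
  iarr : s'.iarr = s.iarr
  rarr : s'.rarr = s.rarr

theorem Scratch.trans {m : ℕ} {s s' s'' : State} (h : Scratch m s s') (h' : Scratch m s' s'') :
    Scratch m s s'' :=
  ⟨fun x hx => (h'.ivar x hx).trans (h.ivar x hx), h'.rvar.trans h.rvar, h'.iarr.trans h.iarr,
    h'.rarr.trans h.rarr⟩

theorem Scratch.mono {m m' : ℕ} {s s' : State} (h : Scratch m s s') (hm : m' ≤ m) :
    Scratch m' s s' := ⟨fun x hx => h.ivar x (by omega), h.rvar, h.iarr, h.rarr⟩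

theorem Scratch.of_setI {m x : ℕ} (hx : m ≤ x) (s : State) (v : ℕ) : Scratch m s (s.setI x v) :=
  ⟨fun y hy => s.setI_ivar_of_ne v (by omega), rfl, rfl, rfl⟩

-- For a quantifier, the variable `m` runs through the range, `m + 1` receives the truth value of
-- each instance, and the search stops at the first witness. Then `m + 1` holds the answer. Each
-- quantifier costs a factor of about `n + b`.
open Classical in
theorem Fm.tri {b m k : ℕ} (hm : m ≠ 0) {f : Fm} (hf : f.Below k m) : Tri (f.compile b m)
    fun s s' => Scratch m s s' ∧ s'.ivar m = if f.holds b m s then 1 else 0 := by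
  induction f generalizing m with
  | test t =>
    refine (Tri.cond t (Tri.setI hm (.const 1)) (Tri.setI hm (.const 0))).mono ?_
    rintro s s' - (⟨ht, rfl⟩ | ⟨ht, rfl⟩) <;>
      exact ⟨.of_setI le_rfl _ _, by simp [Fm.holds, ht, IExp.eval]⟩
  | neg f ih =>
    refine ((ih hm hf).seq (Tri.cond (.ile (.const 1) (.var m)) (Tri.setI hm (.const 0))
      (Tri.setI hm (.const 1)))).mono ?_
    rintro s s' - ⟨s₁, -, ⟨h1, h2⟩, ⟨ht, rfl⟩ | ⟨ht, rfl⟩⟩ <;>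
      refine ⟨h1.trans (.of_setI le_rfl _ _), ?_⟩ <;>
      simp only [Test.holds, IExp.eval, h2] at ht <;>
      by_cases hh : f.holds b m s <;> simp_all [Fm.holds, IExp.eval]
  | and f g ih ih' =>
    refine ((ih hm hf.1).seq (Tri.cond (.ile (.const 1) (.var m)) (ih' hm hf.2) Tri.skip)).mono ?_
    rintro s s' - ⟨s₁, -, ⟨h1, h2⟩, ⟨ht, h3, h4⟩ | ⟨ht, rfl⟩⟩
    · refine ⟨h1.trans h3, ?_⟩
      simp only [Test.holds, IExp.eval, h2] at ht
      rw [Fm.holds_congr hm (fun k' _ => congrFun h1.iarr k') h1.ivar hf.2] at h4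
      by_cases hh : f.holds b m s <;> simp_all [Fm.holds]
    · refine ⟨h1, ?_⟩
      simp only [Test.holds, IExp.eval, h2] at ht
      by_cases hh : f.holds b m s <;> simp_all [Fm.holds]
  | ex f ih =>
    obtain ⟨T, hT⟩ := (ih (Nat.succ_ne_zero m) hf).seq (Tri.setI hm (.add (.var m) (.const 1)))
    set t : Test := .and (ltBound b m) (.ile (.var (m + 1)) (.const 0)) with ht
    refine ⟨(Polynomial.X + Polynomial.C b) * (T + Polynomial.C t.cost) +
      -- The summand `6` pays for the three assignments outside the loop.
      Polynomial.C t.cost + 6, fun s => ?_⟩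
    have h0m : 0 < m := Nat.pos_of_ne_zero hm
    let s₁ := (s.setI (m + 1) 0).setI m 0
    have hs₁ : Scratch m s s₁ := (Scratch.of_setI (by omega) _ _).trans (.of_setI le_rfl _ _)
    obtain ⟨k, s', τ, h1, h2, ⟨h3, h4, h5, h6, h7⟩, h8⟩ := exists_runs_loop t
      (.seq (f.compile b (m + 1)) (incr m)) (fun k s' => k ≤ s.ivar 0 + b ∧ s'.ivar m = k ∧
        Scratch m s s' ∧ (s'.ivar (m + 1) = 0 → ∀ i < k, ¬ f.holds b (m + 1) (s.setI m i)) ∧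
        (s'.ivar (m + 1) ≠ 0 → ∃ i < s.ivar 0 + b, f.holds b (m + 1) (s.setI m i) ∧
          s'.ivar (m + 1) = 1))
      (s.ivar 0 + b) (T.eval (s.ivar 0)) (by
        rintro k s₂ ⟨h1, h2, h3, h4, h5⟩ hb
        obtain ⟨hb, hb'⟩ := hb
        rw [ltBound_holds, h2, h3.ivar 0 h0m] at hb
        have hb' : s₂.ivar (m + 1) = 0 := Nat.le_zero.mp hb'
        obtain ⟨s₃, τ, g1, g2, g3, s₄, g4, ⟨g5, g6⟩, rfl⟩ := hT s₂
        rw [h3.ivar 0 h0m] at g2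
        have e : s₄.ivar m = k := (g5.ivar m (by omega)).trans h2
        have e' : (IExp.add (.var m) (.const 1)).eval s₄ = k + 1 := by simp [IExp.eval, e]
        rw [e'] at g1
        have hc : f.holds b (m + 1) s₂ ↔ f.holds b (m + 1) (s.setI m k) := by
          refine Fm.holds_congr (s := s.setI m k) (Nat.succ_ne_zero m)
            (fun k' _ => congrFun h3.iarr k') (fun x hx => ?_) hf
          by_cases hxm : x = m
          · simp [hxm, h2]
          · rw [State.setI_ivar_of_ne _ _ hxm]
            exact h3.ivar x (by omega)
        rw [hc] at g6
        have e'' : (s₄.setI m (k + 1)).ivar (m + 1) = s₄.ivar (m + 1) :=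
          State.setI_ivar_of_ne _ _ (by omega)
        refine ⟨hb, _, τ, g1, g2, hb, by simp,
          (h3.trans (g5.mono (by omega))).trans (.of_setI le_rfl _ _), ?_, ?_⟩
        · rw [e'', g6]
          intro h0 i hi
          rcases Nat.lt_succ_iff_lt_or_eq.mp hi with hi | rfl
          · exact h4 hb' i hi
          · intro hh
            simp [hh] at h0
        · rw [e'', g6]
          intro h0
          by_cases hh : f.holds b (m + 1) (s.setI m k)
          · exact ⟨k, hb, hh, by simp [hh]⟩
          · simp [hh] at h0)
      s₁ ⟨by simp, by simp [s₁], hs₁, by simp, fun h => absurd (by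
        rw [State.setI_ivar_of_ne _ _ (by omega)]; simp) h⟩
    have hfin : Scratch m s (s'.setI m (s'.ivar (m + 1))) := h5.trans (.of_setI le_rfl _ _)
    refine ⟨_, _, .seq (.seq (.setI s (m + 1) (.const 0)) (.setI _ m (.const 0)))
      (.seq h1 (.setI s' m (.var (m + 1)))), ?_, hfin.ivar 0 h0m, hfin, ?_⟩
    · simp only [IExp.cost, Polynomial.eval_add, Polynomial.eval_mul, Polynomial.eval_X,
        Polynomial.eval_C, Polynomial.eval_ofNat]
      omega
    · have e : (IExp.var (m + 1)).eval s' = s'.ivar (m + 1) := rfl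
      rw [e]
      show (s'.setI m (s'.ivar (m + 1))).ivar m = _
      rw [State.setI_ivar_self]
      by_cases h0 : s'.ivar (m + 1) = 0
      · have hk : k = s.ivar 0 + b := by
          by_contra hk
          refine h8 ⟨?_, h0.le⟩
          rw [ltBound_holds, h4, h5.ivar 0 h0m]
          omega
        rw [h0, if_neg]
        rintro ⟨i, hi, hh⟩
        exact h6 h0 i (hk ▸ hi) hh
      · obtain ⟨i, hi, hh, h1⟩ := h7 h0
        rw [h1, if_pos]
        exact ⟨i, hi, hh⟩

end RealRAM

/-! ### Loops over the vertices -/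

namespace RealRAM

variable {p q : Prog} {Q R : State → State → Prop}

theorem update3_of_ne {f : ℕ → ℕ → ℕ → ℕ} {k k' : ℕ} (h : k' ≠ k) (i j x : ℕ) :
    update3 f k i j x k' = f k' := by
  funext i' j'
  simp [update3, h]

theorem Upd.trans {m k : ℕ} {s s' s'' : State} (h : Upd m k s s') (h' : Upd m k s' s'') :
    Upd m k s s'' :=
  ⟨fun x hx => (h'.ivar x hx).trans (h.ivar x hx), h'.rvar.trans h.rvar,
    fun k' hk => (h'.iarr k' hk).trans (h.iarr k' hk), h'.rarr.trans h.rarr⟩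

theorem Upd.mono {m m' k : ℕ} {s s' : State} (h : Upd m k s s') (hm : m' ≤ m) : Upd m' k s s' :=
  ⟨fun x hx => h.ivar x (by omega), h.rvar, h.iarr, h.rarr⟩

theorem Scratch.upd {m : ℕ} {s s' : State} (h : Scratch m s s') (k : ℕ) : Upd m k s s' :=
  ⟨h.ivar, h.rvar, fun k' _ => congrFun h.iarr k', h.rarr⟩

theorem Upd.of_setI {m x : ℕ} (hx : m ≤ x) (k : ℕ) (s : State) (v : ℕ) :
    Upd m k s (s.setI x v) := (Scratch.of_setI hx s v).upd k

theorem Upd.write (m k : ℕ) (s : State) (i j x : ℕ) :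
    Upd m k s { s with iarr := update3 s.iarr k i j x } :=
  ⟨fun _ _ => rfl, rfl, fun _ hk => update3_of_ne hk _ _ _, rfl⟩

/-- The test that the truth value in the variable `m` is positive. -/
def isTrue (m : ℕ) : Test := .ile (.const 1) (.var m)

/-- The entries of the integer array `m + 2` are set to the truth values of the formula `f`, with
the indices in the variables `m` and `m + 1`. -/
def fill (b m : ℕ) (f : Fm) : Prog :=
  forN b m (forN b (m + 1) (.seq (f.compile b (m + 2))
    (.writeI (m + 2) (.var m) (.var (m + 1)) (.var (m + 2)))))

theorem fill_tri {b m : ℕ} (hm : m ≠ 0) {f : Fm} (hf : f.Below (m + 2) (m + 2)) :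
    Tri (fill b m f) fun s s' => Upd m (m + 2) s s' ∧
      ∀ v < s.ivar 0 + b, ∀ c < s.ivar 0 + b, (1 ≤ s'.iarr (m + 2) v c ↔
        f.holds b (m + 2) ((s.setI m v).setI (m + 1) c)) := by
  classical
  have inner := Tri.forN (b := b) (x := m + 1) (by omega)
    ((Fm.tri (b := b) (m := m + 2) (by omega) hf).seq
      (Tri.writeI (m + 2) (.var m) (.var (m + 1)) (.var (m + 2))))
    (fun s₀ c s => Upd (m + 1) (m + 2) s₀ s ∧
      (∀ v ≠ s₀.ivar m, ∀ c', s.iarr (m + 2) v c' = s₀.iarr (m + 2) v c') ∧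
      ∀ c' < c, (1 ≤ s.iarr (m + 2) (s₀.ivar m) c' ↔ f.holds b (m + 2) (s₀.setI (m + 1) c')))
    (fun s => ⟨.of_setI le_rfl _ _ _, fun _ _ _ => rfl, fun _ h => absurd h (by omega)⟩)
    (by
      rintro s₀ c s s' hc h0 hx ⟨h1, h2, h3⟩ h0' ⟨s₁, -, ⟨g1, g2⟩, rfl⟩
      have e0 : s₁.ivar (m + 1) = c := (g1.ivar _ (by omega)).trans hx
      have e1 : s₁.ivar m = s₀.ivar m := (g1.ivar _ (by omega)).trans (h1.ivar _ (by omega))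
      refine ⟨e0, ?_, ?_, ?_⟩
      · exact ((h1.trans ((g1.upd (m + 2)).mono (by omega))).trans (.write _ _ _ _ _ _)).trans
          (.of_setI le_rfl _ _ _)
      · intro v hv c'
        simp only [State.setI_iarr, update3, IExp.eval, e1, hv, false_and, and_false, if_false,
          g1.iarr]
        exact h2 v hv c'
      · intro c' hc'
        simp only [State.setI_iarr, update3, IExp.eval, e0, e1, true_and, g1.iarr]
        by_cases hcc : c' = c
        · subst hcc
          have hh : f.holds b (m + 2) s ↔ f.holds b (m + 2) (s₀.setI (m + 1) c') := by
            refine Fm.holds_congr (s := s₀.setI (m + 1) c') (by omega) h1.iarr (fun x hx' => ?_) hf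
            by_cases hxm : x = m + 1
            · simp [hxm, hx]
            · rw [State.setI_ivar_of_ne _ _ hxm]
              exact h1.ivar x (by omega)
          rw [if_pos rfl, g2, ← hh]
          split_ifs with h <;> simp [h]
        · rw [if_neg hcc]
          exact h3 c' (by omega))
  refine (Tri.forN (b := b) hm inner (fun s₀ v s => Upd m (m + 2) s₀ s ∧
    ∀ v' < v, ∀ c < s₀.ivar 0 + b, (1 ≤ s.iarr (m + 2) v' c ↔
        f.holds b (m + 2) ((s₀.setI m v').setI (m + 1) c)))
    (fun s => ⟨.of_setI le_rfl _ _ _, fun _ h => absurd h (by omega)⟩) ?_)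
  rintro s₀ v s s' hv h0 hx ⟨h1, h2⟩ h0' ⟨g1, g2, g3⟩
  refine ⟨(g1.ivar m (by omega)).trans hx,
    (h1.trans (g1.mono (by omega))).trans (.of_setI le_rfl _ _ _), fun v' hv' c hc => ?_⟩
  rw [State.setI_iarr]
  by_cases hvv : v' = v
  · subst hvv
    rw [hx] at g3
    rw [g3 c (by omega)]
    refine Fm.holds_congr (s := (s₀.setI m v').setI (m + 1) c) (s' := s.setI (m + 1) c)
      (by omega) h1.iarr (fun x hx' => ?_) hf
    by_cases hxm : x = m + 1
    · simp [hxm]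
    · rw [State.setI_ivar_of_ne _ _ hxm, State.setI_ivar_of_ne _ _ hxm]
      by_cases hxm' : x = m
      · simp [hxm', hx]
      · rw [State.setI_ivar_of_ne _ _ hxm']
        exact h1.ivar x (by omega)
  · rw [g2 v' (by omega)]
    exact h2 v' (by omega) c hc

/-- The entries of column `0` of the integer array `k` with formula `f` true for the index, in the
variable `m`, are set to the value of `e`. -/
def mapCol (b m k : ℕ) (f : Fm) (e : IExp) : Prog :=
  forN b m (.seq (f.compile b (m + 1)) (.cond (isTrue (m + 1))
    (.writeI k (.var m) (.const 0) e) .skip))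

-- Neither `f` nor `e` reads the array `k`, so entries already written do not influence later ones.
open Classical in
theorem mapCol_tri {b m k : ℕ} (hm : m ≠ 0) {f : Fm} (hf : f.Below k (m + 1)) {e : IExp}
    (he : e.Below (m + 1) k) : Tri (mapCol b m k f e) fun s s' => Upd m k s s' ∧
      ∀ v < s.ivar 0 + b, s'.iarr k v 0 =
        if f.holds b (m + 1) (s.setI m v) then e.eval (s.setI m v) else s.iarr k v 0 := by
  have body := (Fm.tri (b := b) (m := m + 1) (by omega) hf).seq
    (Tri.cond (isTrue (m + 1)) (Tri.writeI k (.var m) (.const 0) e) Tri.skip)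
  refine (Tri.forN (b := b) hm body (fun s₀ v s => Upd m k s₀ s ∧
    (∀ v' ≥ v, s.iarr k v' 0 = s₀.iarr k v' 0) ∧ ∀ v' < v, s.iarr k v' 0 =
      if f.holds b (m + 1) (s₀.setI m v') then e.eval (s₀.setI m v') else s₀.iarr k v' 0)
    (fun s => ⟨.of_setI le_rfl _ _ _, fun _ _ => rfl, fun _ h => absurd h (by omega)⟩) ?_).mono
    fun s s' _ h => ⟨h.1, h.2.2⟩
  rintro s₀ v s s' hv h0 hx ⟨h1, h2, h3⟩ h0' ⟨s₁, -, ⟨g1, g2⟩, g3⟩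
  have e0 : s₁.ivar m = v := (g1.ivar _ (by omega)).trans hx
  have hvar : ∀ x < m + 1, s.ivar x = (s₀.setI m v).ivar x := fun x hx' => by
    by_cases hxm : x = m
    · simp [hxm, hx]
    · rw [State.setI_ivar_of_ne _ _ hxm]
      exact h1.ivar x (by omega)
  have hh : f.holds b (m + 1) s ↔ f.holds b (m + 1) (s₀.setI m v) :=
    Fm.holds_congr (s := s₀.setI m v) (by omega) h1.iarr hvar hf
  have he₁ : e.eval s₁ = e.eval (s₀.setI m v) :=
    (IExp.eval_congr (fun k' _ => congrFun g1.iarr k') g1.ivar he).trans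
      (IExp.eval_congr (s := s₀.setI m v) h1.iarr hvar he)
  have ht : (isTrue (m + 1)).holds s₁ ↔ f.holds b (m + 1) (s₀.setI m v) := by
    simp only [isTrue, Test.holds, IExp.eval, g2, hh]
    split_ifs with h <;> simp [h]
  have hU := h1.trans ((g1.upd k).mono (Nat.le_succ m))
  rcases g3 with ⟨hb, rfl⟩ | ⟨hb, rfl⟩
  · refine ⟨e0, (hU.trans (.write _ _ _ _ _ _)).trans
      (.of_setI le_rfl _ _ _), fun v' hv' => ?_, fun v' hv' => ?_⟩ <;>
      simp only [State.setI_iarr, update3, IExp.eval, e0, true_and, and_true, g1.iarr]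
    · rw [if_neg (by omega)]
      exact h2 v' (by omega)
    · by_cases hvv : v' = v
      · subst hvv
        rw [if_pos rfl, if_pos (ht.mp hb), he₁]
      · rw [if_neg hvv]
        exact h3 v' (by omega)
  · refine ⟨e0, hU.trans (.of_setI le_rfl _ _ _), fun v' hv' => ?_, fun v' hv' => ?_⟩ <;>
      simp only [State.setI_iarr, g1.iarr]
    · exact h2 v' (by omega)
    · by_cases hvv : v' = v
      · subst hvv
        rw [if_neg (fun h => hb (ht.mpr h))]
        exact h2 v' le_rfl
      · exact h3 v' (by omega)

/-- The revenue of the coloring in column `0` of the integer array `k` is computed in the real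
variable `ρ`. -/
def sumCol (b m k ρ : ℕ) : Prog :=
  .seq (.setR ρ .zero) (forN b m (.cond
    (.and (.ile (.const 1) (.read k (.var m) (.const 0))) (.neg (.ile (.var 0) (.var m))))
    (.setR ρ (.add (.var ρ) (.read 0 (.var m) (.sub (.read k (.var m) (.const 0)) (.const 1)))))
    .skip))

-- The loop may run beyond the vertices, hence the test for indices from `n` on. The code `0` is
-- skipped because it earns nothing.
open PartialColoring in
theorem sumCol_tri {b m k ρ : ℕ} (hm : m ≠ 0) : Tri (sumCol b m k ρ) fun s s' =>
    (∀ x < m, s'.ivar x = s.ivar x) ∧ s'.iarr = s.iarr ∧ s'.rarr = s.rarr ∧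
      (∀ x ≠ ρ, s'.rvar x = s.rvar x) ∧
      s'.rvar ρ = ∑ v ∈ Finset.range (s.ivar 0), gain (s.rarr 0) v (s.iarr k v 0) := by
  refine ((Tri.setR ρ .zero).seq (Tri.forN (b := b) hm (Tri.cond
    (.and (.ile (.const 1) (.read k (.var m) (.const 0))) (.neg (.ile (.var 0) (.var m))))
    (Tri.setR ρ (.add (.var ρ) (.read 0 (.var m)
      (.sub (.read k (.var m) (.const 0)) (.const 1))))) Tri.skip)
    (fun s₀ v s => (∀ x < m, s.ivar x = s₀.ivar x) ∧ s.iarr = s₀.iarr ∧ s.rarr = s₀.rarr ∧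
      (∀ x ≠ ρ, s.rvar x = s₀.rvar x) ∧ s.rvar ρ = s₀.rvar ρ + ∑ v ∈ Finset.range v,
        if v < s₀.ivar 0 then gain (s₀.rarr 0) v (s₀.iarr k v 0) else 0)
    (fun s => ⟨fun x hx => s.setI_ivar_of_ne _ (by omega), rfl, rfl, fun _ _ => rfl, by simp⟩)
    ?_)).mono ?_
  · rintro s₀ v s s' hv h0 hx ⟨h1, h2, h3, h4, h5⟩ h0' hs'
    have hset : ∀ x < m, (s.setI m (v + 1)).ivar x = s₀.ivar x := fun x hx =>
      (s.setI_ivar_of_ne _ (by omega)).trans (h1 x hx)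
    rcases hs' with ⟨hb, rfl⟩ | ⟨hb, rfl⟩
    · refine ⟨hx, hset, h2, h3, fun x hxρ => ?_, ?_⟩
      · simp only [State.setI_rvar, Function.update_of_ne hxρ]
        exact h4 x hxρ
      · simp only [State.setI_rvar, Function.update_self, RExp.eval, IExp.eval, hx, h5, h2, h3,
          Finset.sum_range_succ]
        simp only [Test.holds, IExp.eval, hx, h0, h2] at hb
        rw [if_pos (by omega), gain, if_neg (by omega), add_assoc]
    · refine ⟨hx, hset, h2, h3, h4, ?_⟩
      simp only [State.setI_rvar, h5, Finset.sum_range_succ]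
      simp only [Test.holds, IExp.eval, hx, h0, h2] at hb
      have : (if v < s₀.ivar 0 then gain (s₀.rarr 0) v (s₀.iarr k v 0) else 0) = 0 := by
        split_ifs with hlt
        · rw [gain, if_pos (by omega)]
        · rfl
      rw [this, add_zero]
  · rintro s s' - ⟨s₁, -, rfl, h1, h2, h3, h4, h5⟩
    refine ⟨h1, h2, h3, fun x hx => ?_, ?_⟩
    · rw [h4 x hx]
      simp [hx]
    · rw [h5]
      simp only [Function.update_self, RExp.eval, zero_add, Finset.sum_range_add]
      rw [Finset.sum_congr rfl fun v hv => if_pos (Finset.mem_range.mp hv),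
        Finset.sum_eq_zero (s := Finset.range b) (fun x _ => if_neg (by omega)), add_zero]

/-! ### Enumerating tuples -/

/-- The program `p` is run for all choices of the entries `0, …, j - 1` of column `0` of the integer
array `k`. The loop variables are named `x, …, x + j - 1`. -/
def tupleLoop (b x k : ℕ) (p : Prog) : ℕ → Prog
  | 0 => p
  | j + 1 => forN b (x + j)
      (.seq (.writeI k (.const j) (.const 0) (.var (x + j))) (tupleLoop b x k p j))

/-- `Inv` is an invariant of `p` that does not depend on the loop variables and the tuple, `Done` is
stable, and it is reached if `p` is run for a tuple in `Goal`. -/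
theorem tupleLoop_tri {b x k K : ℕ} (hx : x ≠ 0) {γ : Type} (Inv Done : γ → State → Prop)
    (Goal : γ → (ℕ → ℕ) → Prop) (hgoal : ∀ g f f', (∀ i < K, f i = f' i) → Goal g f → Goal g f')
    (hset : ∀ g s j v, j < K → Inv g s → Inv g (s.setI (x + j) v) ∧
      (Done g s → Done g (s.setI (x + j) v)))
    (hwrite : ∀ g s i v, Inv g s → Inv g { s with iarr := update3 s.iarr k i 0 v } ∧
      (Done g s → Done g { s with iarr := update3 s.iarr k i 0 v }))
    (hp : Tri p fun s s' => (∀ y < x + K, s'.ivar y = s.ivar y) ∧ s'.iarr k = s.iarr k ∧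
      ∀ g, Inv g s → Inv g s' ∧ (Done g s → Done g s') ∧
        (Goal g (fun i => s.iarr k i 0) → Done g s')) :
    ∀ j ≤ K, Tri (tupleLoop b x k p j) fun s s' =>
      (∀ y < x + K, y < x ∨ x + j ≤ y → s'.ivar y = s.ivar y) ∧
      (∀ i ≥ j, s'.iarr k i 0 = s.iarr k i 0) ∧
      ∀ g, Inv g s → Inv g s' ∧ (Done g s → Done g s') ∧
        ∀ f : ℕ → ℕ, (∀ i < j, f i < s.ivar 0 + b) → (∀ i ≥ j, f i = s.iarr k i 0) → Goal g f →
          Done g s' := by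
  intro j
  induction j with
  | zero =>
    refine fun _ => hp.mono fun s s' _ ⟨h1, h2, h3⟩ => ⟨fun y hy _ => h1 y hy,
      fun i _ => by rw [h2], fun g hg => ⟨(h3 g hg).1, (h3 g hg).2.1, fun f _ hf hG =>
        (h3 g hg).2.2 (hgoal g f _ (fun i _ => hf i (Nat.zero_le i)) hG)⟩⟩
  | succ j ih =>
    intro hj
    refine Tri.forN (b := b) (x := x + j) (by omega)
      ((Tri.writeI k (.const j) (.const 0) (.var (x + j))).seq (ih (by omega)))
      (fun s₀ v s => (∀ y < x + K, y < x ∨ x + (j + 1) ≤ y → s.ivar y = s₀.ivar y) ∧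
        (∀ i ≥ j + 1, s.iarr k i 0 = s₀.iarr k i 0) ∧
        ∀ g, Inv g s₀ → Inv g s ∧ (Done g s₀ → Done g s) ∧ ∀ f : ℕ → ℕ,
          (∀ i < j + 1, f i < s₀.ivar 0 + b) → (∀ i ≥ j + 1, f i = s₀.iarr k i 0) → f j < v →
            Goal g f → Done g s)
      (fun s => ⟨fun y _ hy => s.setI_ivar_of_ne _ (by omega), fun _ _ => rfl, fun g hg =>
        ⟨(hset g s j 0 (by omega) hg).1, (hset g s j 0 (by omega) hg).2,
          fun f _ _ h => absurd h (by omega)⟩⟩) ?_ |>.mono ?_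
    · rintro s₀ v s s' hv h0 hxv ⟨h1, h2, h3⟩ h0' ⟨s₁, h01, rfl, g1, g2, g3⟩
      simp only [IExp.eval, hxv] at g1 g2 g3
      refine ⟨(g1 _ (by omega) (by omega)).trans hxv, fun y hy hy' => ?_, fun i hi => ?_,
        fun g hg => ?_⟩
      · rw [State.setI_ivar_of_ne _ _ (by omega), g1 y hy (by omega), h1 y hy hy']
      · rw [State.setI_iarr, g2 i (by omega), update3, if_neg (by omega), h2 i hi]
      · obtain ⟨i1, d1, d2⟩ := h3 g hg
        obtain ⟨i2, d3⟩ := hwrite g s j v i1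
        obtain ⟨i3, d4, d5⟩ := g3 g i2
        obtain ⟨i4, d6⟩ := hset g s' j (v + 1) (by omega) i3
        refine ⟨i4, fun h => d6 (d4 (d3 (d1 h))), fun f hf hf' hfv hG => d6 ?_⟩
        -- The tuple is met either in the present round or in an earlier one.
        by_cases hfj : f j = v
        · refine d5 f (fun i hi => ?_) (fun i hi => ?_) hG
          · rw [h0]
            exact hf i (by omega)
          · by_cases hij : i = j
            · subst hij
              simp [update3, hfj]
            · rw [update3, if_neg (by omega), h2 i (by omega), hf' i (by omega)]
        · exact d4 (d3 (d2 f hf hf' (by omega) hG))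
    · rintro s s' - ⟨h1, h2, h3⟩
      exact ⟨h1, h2, fun g hg => ⟨(h3 g hg).1, (h3 g hg).2.1, fun f hf hf' hG =>
        (h3 g hg).2.2 f hf hf' (hf j (by omega)) hG⟩⟩

end RealRAM

/-! ## Programs that solve list instances -/

namespace RealRAM

namespace Fm

/-- A formula that is always true. -/
def tt : Fm := .test (.ile (.const 0) (.const 0))

/-- Adjacency in the input graph. -/
def adj (i j : IExp) : Fm := .test (.ile (.const 1) (.read 0 i j))

/-- Adjacency of colors, which is stored in the integer array `2`. -/
def hadj (i j : IExp) : Fm := .test (.ile (.const 1) (.read 2 i j))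

def eq (i j : IExp) : Fm := .test (.and (.ile i j) (.ile j i))
def lt (i j : IExp) : Fm := .test (.neg (.ile j i))
def or (f g : Fm) : Fm := .neg (.and (.neg f) (.neg g))
def imp (f g : Fm) : Fm := .neg (.and f (.neg g))
def all (f : Fm) : Fm := .neg (.ex (.neg f))

variable {b m : ℕ} {s : State} {i j : IExp} {f g : Fm}

@[simp] theorem holds_tt : tt.holds b m s := Nat.le_refl 0

@[simp] theorem holds_adj : (adj i j).holds b m s ↔ 1 ≤ s.iarr 0 (i.eval s) (j.eval s) := Iff.rfl

@[simp] theorem holds_hadj : (hadj i j).holds b m s ↔ 1 ≤ s.iarr 2 (i.eval s) (j.eval s) :=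
  Iff.rfl

@[simp] theorem holds_eq : (eq i j).holds b m s ↔ i.eval s = j.eval s := Nat.le_antisymm_iff.symm

@[simp] theorem holds_lt : (lt i j).holds b m s ↔ i.eval s < j.eval s := by
  simp [lt, holds, Test.holds]

@[simp] theorem holds_or : (or f g).holds b m s ↔ f.holds b m s ∨ g.holds b m s := by
  simp only [or, holds]
  tauto

@[simp] theorem holds_imp : (imp f g).holds b m s ↔ (f.holds b m s → g.holds b m s) := by
  simp only [imp, holds]
  tauto

@[simp] theorem holds_all : (all f).holds b m s ↔
    ∀ k < s.ivar 0 + b, f.holds b (m + 1) (s.setI m k) := by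
  simp [all, holds]

@[simp] theorem holds_and : (and f g).holds b m s ↔ f.holds b m s ∧ g.holds b m s := Iff.rfl

@[simp] theorem holds_ex : (ex f).holds b m s ↔
    ∃ k < s.ivar 0 + b, f.holds b (m + 1) (s.setI m k) := Iff.rfl

end Fm

end RealRAM

namespace PartialColoring

open RealRAM

variable {H : SimpleGraph ℕ} {h : ℕ} {I : Inst}

/-- The state `s` stores the graph and the revenues of `I` and the graph `H`. -/
structure Env (H : SimpleGraph ℕ) (I : Inst) (s : State) : Prop where
  n : s.ivar 0 = I.n
  adj : ∀ u v, 1 ≤ s.iarr 0 u v ↔ I.G.Adj u v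
  hadj : ∀ a b, 1 ≤ s.iarr 2 a b ↔ H.Adj a b
  rev : s.rarr 0 = I.r

/-- The lists that are stored in the integer array `m`. -/
def lists (h : ℕ) (s : State) (m : ℕ) : ℕ → ℕ → Prop := fun v c =>
  v < s.ivar 0 ∧ c < h ∧ 1 ≤ s.iarr m v c

/-- The column `0` of the integer array `m`. -/
def col (s : State) (m : ℕ) : ℕ → ℕ := fun v => s.iarr m v 0

theorem Env.congr {s s' : State} (hs : Env H I s) (h0 : s'.ivar 0 = s.ivar 0)
    (h1 : s'.iarr 0 = s.iarr 0) (h2 : s'.iarr 2 = s.iarr 2) (h3 : s'.rarr 0 = s.rarr 0) :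
    Env H I s' :=
  ⟨h0.trans hs.n, by rw [h1]; exact hs.adj, by rw [h2]; exact hs.hadj, h3.trans hs.rev⟩

theorem Env.agree {m : ℕ} (hm : 3 ≤ m) {s s' : State} (hs : Env H I s) (ha : Agree m s s') :
    Env H I s' :=
  hs.congr (ha 0 (by omega)).1 (ha 0 (by omega)).2.2.1 (ha 2 (by omega)).2.2.1
    (ha 0 (by omega)).2.2.2

theorem lists_congr {s s' : State} {m : ℕ} (h0 : s'.ivar 0 = s.ivar 0)
    (h1 : s'.iarr m = s.iarr m) : lists h s' m = lists h s m := by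
  funext v c
  simp only [lists, h0, h1]

theorem lists_setI {s : State} {m x : ℕ} (hx : x ≠ 0) (v : ℕ) :
    lists h (s.setI x v) m = lists h s m :=
  lists_congr (s.setI_ivar_of_ne v hx.symm) rfl

/-- The programs `p m` find valid colorings, and optimal ones in the class `K`. The lists are in the
integer array `m`, the result is in the integer array `m + 1`, and the memory with names up to
`m` does not change. -/
def Solver (H : SimpleGraph ℕ) (h : ℕ) (p : ℕ → Prog) (K : Inst → (ℕ → ℕ → Prop) → Prop) : Prop :=
  ∀ m ≥ 3, Tri (p m) fun s s' => Agree (m + 1) s s' ∧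
    ∀ I, Env H I s → Sol H K I (lists h s m) (col s' (m + 1))

theorem Solver.mono {p : ℕ → Prog} {K K' : Inst → (ℕ → ℕ → Prop) → Prop} (hp : Solver H h p K)
    (hK : ∀ I L, K' I L → K I L) : Solver H h p K' := fun m hm =>
  (hp m hm).mono fun _ _ _ hs => ⟨hs.1, fun I hI =>
    ⟨(hs.2 I hI).1, fun hL => (hs.2 I hI).2 (hK I _ hL)⟩⟩

/-- Instances with empty lists are solved by the empty coloring. -/
theorem exists_solver_empty (H : SimpleGraph ℕ) (h : ℕ) :
    ∃ p, Solver H h p fun _ L => supp L = ∅ := by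
  refine ⟨fun m => mapCol 0 (m + 1) (m + 1) .tt (.const 0), fun m hm =>
    (mapCol_tri (by omega) (by simp [Fm.tt, Fm.Below, Test.Below, IExp.Below])
      (by simp [IExp.Below])).mono ?_⟩
  rintro s s' - ⟨h1, h2⟩
  refine ⟨h1.agree le_rfl le_rfl, fun I hI => ?_⟩
  have h0 : ∀ v < I.n, col s' (m + 1) v = 0 := fun v hv => by
    simpa [IExp.eval, col] using h2 v (by simpa [hI.n])
  refine ⟨valid_zero h0, fun hK ψ hψ => ?_⟩
  rw [total_zero h0, total_zero fun v hv => hψ.eq_zero hv (by simp [hK])]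

/-! ### Components -/

/-- The vertex in the variable `x` has a nonempty list in the array `m`. -/
def suppFm (h m l x : ℕ) : Fm := .and (.lt (.var x) (.var 0))
  (.ex (.and (.lt (.var l) (.const h)) (.test (.ile (.const 1) (.read m (.var x) (.var l))))))

/-- The vertices in the variables `x` and `y` are linked in the support of the lists in the
array `m`. -/
def linkFm (h m l x y : ℕ) : Fm := .and (suppFm h m l x) (.and (suppFm h m l y)
  (.ex (.and (suppFm h m (l + 1) l) (.ex (.and (suppFm h m (l + 2) (l + 1))
    (.and (.or (.eq (.var x) (.var l)) (.adj (.var x) (.var l)))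
      (.and (.or (.eq (.var l) (.var (l + 1))) (.adj (.var l) (.var (l + 1))))
        (.or (.eq (.var (l + 1)) (.var y)) (.adj (.var (l + 1)) (.var y))))))))))

theorem holds_suppFm {m l x : ℕ} (hx : x < l) {s : State} :
    (suppFm h m l x).holds (h + 1) l s ↔ s.ivar x ∈ supp (lists h s m) := by
  have e0 : ∀ c, (s.setI l c).ivar x = s.ivar x := fun c => s.setI_ivar_of_ne c (by omega)
  simp only [suppFm, Fm.holds_and, Fm.holds_lt, Fm.holds, Test.holds, IExp.eval,
    State.setI_ivar_self, State.setI_iarr, e0, supp, lists, Set.mem_ofPred_eq]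
  constructor
  · rintro ⟨h1, c, -, h2, h3⟩
    exact ⟨c, h1, h2, h3⟩
  · rintro ⟨c, h1, h2, h3⟩
    exact ⟨h1, c, by omega, h2, h3⟩

/-- Bounding the quantifiers loses nothing: the inner vertices of a link are in the support, hence
below `n`. -/
theorem holds_linkFm {m l x y : ℕ} (hl : 0 < l) (hx : x < l) (hy : y < l) {s : State}
    (hI : Env H I s) : (linkFm h m l x y).holds (h + 1) l s ↔
      Link I.G (supp (lists h s m)) (s.ivar x) (s.ivar y) := by
  have e1 : ∀ a, ∀ z < l, (s.setI l a).ivar z = s.ivar z := fun a z hz =>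
    s.setI_ivar_of_ne a (by omega)
  have e2 : ∀ a c, ∀ z < l, ((s.setI l a).setI (l + 1) c).ivar z = s.ivar z := fun a c z hz => by
    rw [State.setI_ivar_of_ne _ _ (by omega), e1 a z hz]
  have e3 : ∀ a c, ((s.setI l a).setI (l + 1) c).ivar l = a := fun a c => by
    rw [State.setI_ivar_of_ne _ _ (by omega), State.setI_ivar_self]
  have l1 : ∀ a, lists h (s.setI l a) m = lists h s m := fun a =>
    lists_congr (e1 a 0 hl) rfl
  have l2 : ∀ a c, lists h ((s.setI l a).setI (l + 1) c) m = lists h s m := fun a c =>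
    lists_congr (e2 a c 0 hl) rfl
  simp only [linkFm, Fm.holds_and, holds_suppFm hx, holds_suppFm hy, Fm.holds_ex,
    holds_suppFm (m := m) (h := h) (Nat.lt_succ_self l),
    holds_suppFm (m := m) (h := h) (Nat.lt_succ_self (l + 1)), Fm.holds_or,
    Fm.holds_eq, Fm.holds_adj, IExp.eval, State.setI_iarr, State.setI_ivar_self, e3, l1, l2, hI.adj,
    e2 _ _ x hx, e2 _ _ y hy, Link]
  refine and_congr_right fun _ => and_congr_right fun _ => ⟨?_, ?_⟩
  · rintro ⟨a, -, h1, c, -, h2, h3⟩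
    exact ⟨a, h1, c, h2, h3⟩
  · rintro ⟨a, h1, c, h2, h3⟩
    have ha : a < s.ivar 0 := h1.choose_spec.1
    have hc : c < s.ivar 0 := h2.choose_spec.1
    exact ⟨a, by omega, h1, c, by rw [e1 a 0 hl]; omega, h2, h3⟩

theorem below_linkFm {m l x y k : ℕ} (hl : 0 < l) (hx : x < l) (hy : y < l) (hk : 0 ≠ k)
    (hm : m ≠ k) : (linkFm h m l x y).Below k l := by
  simp [linkFm, suppFm, Fm.Below, Test.Below, IExp.Below, Fm.or, Fm.eq, Fm.lt, Fm.adj]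
  omega

/-- A coloring that is valid for the lists of a component vanishes outside of it, so whatever `ψ`
has elsewhere may be masked. -/
theorem Sol.component {K : Inst → (ℕ → ℕ → Prop) → Prop} {L : ℕ → ℕ → Prop} {r : ℕ}
    {φ ψ : ℕ → ℕ} (hφ : Sol H K I (component I.G L r) φ)
    (hψ : ∀ v < I.n, Link I.G (supp L) r v → ψ v = φ v) :
    Sol H K I (PartialColoring.component I.G L r) (mask (fun v => Link I.G (supp L) r v) ψ) := by
  refine hφ.congr fun v hv => ?_
  by_cases hr : Link I.G (supp L) r v
  · simp [mask, hr, hψ v hv hr]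
  · simp only [mask, hr, if_false]
    exact hφ.1.eq_zero hv fun ⟨c, hc⟩ => hr hc.1

/-- A program that solves connected instances gives a program that solves all instances with
components of this kind. -/
theorem Solver.components {p : ℕ → Prog} {K : Inst → (ℕ → ℕ → Prop) → Prop}
    (hp : Solver H h p K) : ∃ p', Solver H h p' (ComponentsIn K) := by
  classical
  -- The component of each index `r` in turn gets its lists in the array `m + 5`, is solved into `m
  -- + 6`, and is copied to `m + 1`. A component is solved once for each of its vertices.
  refine ⟨fun m => .seq (mapCol (h + 1) (m + 3) (m + 1) .tt (.const 0))
    (forN (h + 1) (m + 2) (.seq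
      (fill (h + 1) (m + 3) (.and (linkFm h m (m + 5) (m + 2) (m + 3))
        (.test (.ile (.const 1) (.read m (.var (m + 3)) (.var (m + 4)))))))
      (.seq (p (m + 5)) (mapCol (h + 1) (m + 3) (m + 1) (linkFm h m (m + 4) (m + 2) (m + 3))
        (.read (m + 6) (.var (m + 3)) (.const 0)))))), fun m hm => ?_⟩
  have t0 := mapCol_tri (b := h + 1) (m := m + 3) (k := m + 1) (f := .tt) (e := .const 0) (by omega)
    (by simp [Fm.tt, Fm.Below, Test.Below, IExp.Below]) (by simp [IExp.Below])
  have t1 := fill_tri (b := h + 1) (m := m + 3) (f := .and (linkFm h m (m + 5) (m + 2) (m + 3))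
        (.test (.ile (.const 1) (.read m (.var (m + 3)) (.var (m + 4)))))) (by omega)
    ⟨below_linkFm (by omega) (by omega) (by omega) (by omega) (by omega),
      by simp [Fm.Below, Test.Below, IExp.Below]; omega⟩
  have t2 := hp (m + 5) (by omega)
  have t3 := mapCol_tri (b := h + 1) (m := m + 3) (k := m + 1)
    (f := linkFm h m (m + 4) (m + 2) (m + 3)) (e := .read (m + 6) (.var (m + 3)) (.const 0))
    (by omega) (below_linkFm (by omega) (by omega) (by omega) (by omega) (by omega))
    (by simp [IExp.Below])
  have loop := Tri.forN (b := h + 1) (x := m + 2) (by omega) (t1.seq (t2.seq t3))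
    (fun s₀ r s => Agree (m + 1) s₀ s ∧ ∀ I, Env H I s₀ → (∀ v < I.n, s₀.iarr (m + 1) v 0 = 0) →
      (∀ r' < r, r' < I.n → Sol H K I (component I.G (lists h s₀ m) r')
        (mask (fun v => Link I.G (supp (lists h s₀ m)) r' v) (col s (m + 1)))) ∧
      ∀ v < I.n, col s (m + 1) v ≠ 0 → v ∈ supp (lists h s₀ m))
    (fun s => ⟨(Agree.refl _ _).setI (by omega) _, fun I hI hz => ⟨fun r hr => absurd hr (by omega),
      fun v hv hv0 => absurd (hz v hv) hv0⟩⟩) ?_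
  · refine (t0.seq loop).mono ?_
    rintro s s' - ⟨s₁, h0, ⟨g1, g2⟩, g3, g4⟩
    have a1 : Agree (m + 1) s s₁ := g1.agree (by omega) le_rfl
    refine ⟨a1.trans g3, fun I hI => ?_⟩
    have hI₁ := hI.agree (by omega) a1
    obtain ⟨c1, c2⟩ := g4 I hI₁ fun v hv => by
      simpa [IExp.eval] using g2 v (by rw [hI.n]; omega)
    rw [lists_congr (s := s) h0 (a1 m (by omega)).2.2.1] at c1 c2
    exact Sol.of_components (fun r hr => c1 r (by rw [h0, hI.n]; omega) hr) c2
  · rintro s₀ r s s' hr h0 hx ⟨h1, h2⟩ h0' ⟨s₁, h01, ⟨f1, f2⟩, s₂, h02, ⟨f3, f4⟩, f5, f6⟩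
    have a1 : Agree (m + 3) s s₁ := f1.agree le_rfl (by omega)
    have a2 : Agree (m + 3) s s₂ := a1.trans (f3.mono (by omega))
    have hx₂ : s₂.ivar (m + 2) = r := (a2 (m + 2) (by omega)).1.trans hx
    refine ⟨(f5.ivar (m + 2) (by omega)).trans hx₂,
      ((h1.trans (a2.mono (by omega))).trans (f5.agree (by omega) le_rfl)).setI (by omega) _,
      fun I hI hz => ?_⟩
    obtain ⟨c1, c2⟩ := h2 I hI hz
    have hIs := hI.agree (by omega) h1
    have hI₁ := hIs.agree (by omega) a1
    have hI₂ := hIs.agree (by omega) a2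
    set L := lists h s₀ m with hL
    have hLs : lists h s m = L := lists_congr h0 (h1 m (by omega)).2.2.1
    have hL₂ : lists h s₂ m = L :=
      (lists_congr (a2 0 (by omega)).1 (a2 m (by omega)).2.2.1).trans hLs
    have hlist : lists h s₁ (m + 5) = component I.G L r := by
      funext v c
      simp only [lists, component, restrict, hI₁.n, eq_iff_iff]
      have key : v < I.n → c < h → (1 ≤ s₁.iarr (m + 5) v c ↔
          Link I.G (supp L) r v ∧ 1 ≤ s.iarr m v c) := by
        intro hv hc
        have hJ : Env H I ((s.setI (m + 3) v).setI (m + 4) c) :=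
          hIs.agree (m := m + 3) (by omega)
            (((Agree.refl _ _).setI le_rfl _).setI (by omega) _)
        rw [f2 v (by rw [hIs.n]; omega) c (by omega), Fm.holds_and,
          holds_linkFm (by omega) (by omega) (by omega) hJ, State.setI_ivar_of_ne _ _ (by omega),
          State.setI_ivar_of_ne _ _ (by omega), hx, State.setI_ivar_of_ne _ _ (by omega),
          State.setI_ivar_self, lists_setI (by omega), lists_setI (by omega),
          hLs]
        simp only [Fm.holds, Test.holds, IExp.eval, State.setI_iarr, State.setI_ivar_self,
          State.setI_ivar_of_ne _ _ (show m + 3 ≠ m + 3 + 1 by omega)]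
      constructor
      · rintro ⟨hv, hc, h3⟩
        have := (key hv hc).mp h3
        exact ⟨this.1, hLs ▸ ⟨by rwa [hIs.n], hc, this.2⟩⟩
      · rintro ⟨h3, h4⟩
        rw [← hLs] at h4
        obtain ⟨hv, hc, h5⟩ := h4
        rw [hIs.n] at hv
        exact ⟨hv, hc, (key hv hc).mpr ⟨h3, h5⟩⟩
    have hsol := f4 I hI₁
    rw [hlist] at hsol
    have hcol : ∀ v < I.n, col (s'.setI (m + 2) (r + 1)) (m + 1) v =
        if Link I.G (supp L) r v then col s₂ (m + 6) v else col s (m + 1) v := by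
      intro v hv
      have e : s₂.iarr (m + 1) = s.iarr (m + 1) := (a2 (m + 1) (by omega)).2.2.1
      have hJ : Env H I (s₂.setI (m + 3) v) :=
        hI₂.agree (m := m + 3) (by omega) ((Agree.refl _ _).setI le_rfl _)
      have := f6 v (by rw [hI₂.n]; omega)
      rw [holds_linkFm (by omega) (by omega) (by omega) hJ, State.setI_ivar_of_ne _ _ (by omega),
        hx₂, State.setI_ivar_self, lists_setI (by omega), hL₂, e] at this
      simpa [col, IExp.eval] using this
    refine ⟨fun r' hr' hr'n => ?_, fun v hv hv0 => ?_⟩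
    -- The component just solved is overwritten as a whole, and the other components are untouched.
    · by_cases hrr : Link I.G (supp L) r r'
      · have hiff : ∀ v, Link I.G (supp L) r' v ↔ Link I.G (supp L) r v := fun v =>
          ⟨hrr.trans I.noInducedP5, hrr.symm.trans I.noInducedP5⟩
        simp only [component, hiff]
        exact hsol.component fun v hv hrv => by rw [hcol v hv, if_pos hrv]
      · rcases Nat.lt_succ_iff_lt_or_eq.mp hr' with hlt | rfl
        · refine (c1 r' hlt hr'n).congr fun v hv => ?_
          by_cases hv' : Link I.G (supp L) r' v
          · have : ¬ Link I.G (supp L) r v := fun hrv =>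
              hrr (hrv.trans I.noInducedP5 hv'.symm)
            simp [mask, hv', hcol v hv, this]
          · simp [mask, hv']
        · refine hsol.component fun v hv hrv => by rw [hcol v hv, if_pos hrv]
    · rw [hcol v hv] at hv0
      split_ifs at hv0 with hrv
      · exact hrv.2.1
      · exact c2 v hv hv0

end PartialColoring

/-! ### Separating the neighborhood of a vertex -/

namespace PartialColoring

open RealRAM

variable {H : SimpleGraph ℕ} {h : ℕ} {I : Inst}

/-- The lists `prune`, with the parameters given by a sequence `f`. -/
def pruneBy (H : SimpleGraph ℕ) (h : ℕ) (G : SimpleGraph ℕ) (f : ℕ → ℕ) (L : ℕ → ℕ → Prop) :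
    ℕ → ℕ → Prop :=
  prune H h G (f 0) (f 1) (fun j => f (j + j + 2)) (fun j => f (j + j + 3)) L

/-- Only colors below `h` occur, so `2h + 2` numbers suffice: `u`, `a` and two for each color. The
indices use `j + j` because the machine cannot multiply. -/
theorem pruneBy_congr {G : SimpleGraph ℕ} {f f' : ℕ → ℕ} {L : ℕ → ℕ → Prop}
    (hL : ∀ v c, L v c → c < h) (hf : ∀ i < h + h + 2, f i = f' i) :
    pruneBy H h G f L = pruneBy H h G f' L := by
  funext v c
  refine propext (and_congr_right fun hvc => ?_)
  have hc := hL v c hvc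
  have hr : (∀ j < h, G.Adj (f (j + j + 2)) v ∨ G.Adj (f (j + j + 3)) v → H.Adj j c) ↔
      ∀ j < h, G.Adj (f' (j + j + 2)) v ∨ G.Adj (f' (j + j + 3)) v → H.Adj j c :=
    forall_congr' fun j => forall_congr' fun hj => by
      rw [hf (j + j + 2) (by omega), hf (j + j + 3) (by omega)]
  rw [hr, hf 0 (by omega), hf 1 (by omega)]
  simp only [hf (c + c + 2) (by omega), hf (c + c + 3) (by omega)]

/-- The entry `e` of the sequence of parameters, which is stored in the integer array `m + 3`. -/
def par (m : ℕ) (e : IExp) : IExp := .read (m + 3) e (.const 0)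

/-- The color in the variable `y + 1` is in the pruned list of the vertex in the variable `y`. -/
def pruneFm (h m y : ℕ) : Fm :=
  .and (.and (.lt (.var y) (.var 0)) (.and (.lt (.var (y + 1)) (.const h))
      (.test (.ile (.const 1) (.read m (.var y) (.var (y + 1)))))))
    (.and (.imp (.eq (.var y) (par m (.const 0))) (.eq (.var (y + 1)) (par m (.const 1))))
    (.and (.imp (.adj (par m (.const 0)) (.var y))
      (.and (.imp (.lt (par m (.const 1)) (.const h)) (.hadj (par m (.const 1)) (.var (y + 1))))
        (.all (.imp (.neg (.eq (.var (y + 2)) (par m (.const 0))))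
          (.imp (.neg (.adj (par m (.const 0)) (.var (y + 2))))
          (.imp (.adj (.var y) (.var (y + 2)))
            (.or (.adj (par m (.add (.add (.var (y + 1)) (.var (y + 1))) (.const 2)))
                (.var (y + 2)))
              (.adj (par m (.add (.add (.var (y + 1)) (.var (y + 1))) (.const 3)))
                (.var (y + 2))))))))))
    (.imp (.neg (.eq (.var y) (par m (.const 0)))) (.imp (.neg (.adj (par m (.const 0)) (.var y)))
      (.all (.imp (.lt (.var (y + 2)) (.const h)) (.imp
        (.or (.adj (par m (.add (.add (.var (y + 2)) (.var (y + 2))) (.const 2))) (.var y))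
          (.adj (par m (.add (.add (.var (y + 2)) (.var (y + 2))) (.const 3))) (.var y)))
        (.hadj (.var (y + 2)) (.var (y + 1))))))))))

/-- The quantifiers range below `n + h + 1`, which covers all neighbors `z` and all colors. -/
theorem holds_pruneFm {m y : ℕ} {s : State} (hI : Env H I s) :
    (pruneFm h m y).holds (h + 1) (y + 2) s ↔
      pruneBy H h I.G (col s (m + 3)) (lists h s m) (s.ivar y) (s.ivar (y + 1)) := by
  have e : ∀ a, ∀ z < y + 2, (s.setI (y + 2) a).ivar z = s.ivar z := fun a z hz =>
    s.setI_ivar_of_ne a (by omega)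
  simp only [pruneFm, par, Fm.holds_and, Fm.holds_lt, Fm.holds_imp, Fm.holds_eq, Fm.holds_adj,
    Fm.holds_hadj, Fm.holds_all, Fm.holds_or, IExp.eval, State.setI_iarr,
    State.setI_ivar_self, e _ y (by omega), e _ (y + 1) (by omega), hI.adj, hI.hadj, pruneBy,
    prune, col, lists, Fm.holds, Test.holds]
  refine and_congr_right fun hl => and_congr_right fun _ => and_congr
    (imp_congr_right fun _ => and_congr_right fun _ => ?_)
    (imp_congr_right fun _ => imp_congr_right fun _ => ?_)
  · refine ⟨fun hz z h1 h2 h3 => hz z ?_ h1 h2 h3, fun hz z _ => hz z⟩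
    have := I.lt_of_adj' h3
    rw [hI.n]
    omega
  · exact ⟨fun hz z h1 => hz z (by omega) h1, fun hz z _ => hz z⟩

theorem below_pruneFm {m y k : ℕ} (h0 : 0 ≠ k) (h2 : 2 ≠ k) (hm : m ≠ k) (hm' : m + 3 ≠ k)
    (hy : 0 < y) : (pruneFm h m y).Below k (y + 2) := by
  simp [pruneFm, par, Fm.Below, Test.Below, IExp.Below, Fm.or, Fm.eq, Fm.lt, Fm.adj, Fm.hadj,
    Fm.imp, Fm.all, h0, h2, hm, hm', hy]

/-- The vertex in the variable `y` is the parameter `0`. -/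
def selfFm (m y : ℕ) : Fm := .eq (.var y) (par m (.const 0))

/-- The vertex in the variable `y` is a neighbor of the parameter `0`. -/
def nearFm (m y : ℕ) : Fm := .adj (par m (.const 0)) (.var y)

/-- The vertex in the variable `y` is neither the parameter `0` nor a neighbor. -/
def farFm (m y : ℕ) : Fm := .and (.neg (selfFm m y)) (.neg (nearFm m y))

/-- The memory that the two recursive calls have to preserve. -/
structure Keep (m y : ℕ) (s s' : State) : Prop where
  ivar : ∀ x < y, s'.ivar x = s.ivar x
  rvar : ∀ x < y, s'.rvar x = s.rvar x
  iarr : ∀ k < y, k ≠ m + 2 → s'.iarr k = s.iarr k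
  rarr : ∀ k < y, s'.rarr k = s.rarr k

theorem Keep.trans {m y : ℕ} {s s' s'' : State} (a : Keep m y s s') (b : Keep m y s' s'') :
    Keep m y s s'' :=
  ⟨fun x hx => (b.ivar x hx).trans (a.ivar x hx), fun x hx => (b.rvar x hx).trans (a.rvar x hx),
    fun x hx hx' => (b.iarr x hx hx').trans (a.iarr x hx hx'),
    fun x hx => (b.rarr x hx).trans (a.rarr x hx)⟩

theorem _root_.RealRAM.Upd.keep {m y k : ℕ} {s s' : State} (a : Upd y k s s')
    (hk : k = m + 2 ∨ y ≤ k) : Keep m y s s' :=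
  ⟨a.ivar, fun x _ => by rw [a.rvar], fun x hx hx' => a.iarr x (by omega),
    fun x _ => by rw [a.rarr]⟩

theorem _root_.RealRAM.Agree.keep {m y k : ℕ} {s s' : State} (a : Agree k s s') (hk : y ≤ k) :
    Keep m y s s' :=
  ⟨fun x hx => (a x (by omega)).1, fun x hx => (a x (by omega)).2.1,
    fun x hx _ => (a x (by omega)).2.2.1, fun x hx => (a x (by omega)).2.2.2⟩

theorem Keep.env {m y : ℕ} {s s' : State} (hm : 3 ≤ m) (hy : m + 4 ≤ y) (a : Keep m y s s')
    (hI : Env H I s) : Env H I s' :=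
  hI.congr (a.ivar 0 (by omega)) (a.iarr 0 (by omega) (by omega)) (a.iarr 2 (by omega) (by omega))
    (a.rarr 0 (by omega))

theorem Keep.col {m y k : ℕ} {s s' : State} (a : Keep m y s s') (hk : k < y) (hk' : k ≠ m + 2) :
    col s' k = col s k := by
  simp only [funext_iff, PartialColoring.col, a.iarr k hk hk', implies_true]

theorem Keep.lists {m y : ℕ} {s s' : State} (hy : m + 4 ≤ y) (a : Keep m y s s') :
    lists h s' m = lists h s m :=
  lists_congr (a.ivar 0 (by omega)) (a.iarr m (by omega) (by omega))

/-- The colorings that are found for the neighborhood and the non-neighbors of the parameter `0` are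
put together in column `0` of the integer array `m + 2`. -/
def combineProg (h : ℕ) (pA pB : ℕ → Prog) (m y : ℕ) : Prog :=
  .seq (fill (h + 1) y (.and (nearFm m y) (pruneFm h m y)))
  (.seq (pA (y + 2))
  (.seq (mapCol (h + 1) y (m + 2) (nearFm m y) (.read (y + 3) (.var y) (.const 0)))
  (.seq (mapCol (h + 1) y (m + 2) (selfFm m y) (.const 0))
  (.seq (mapCol (h + 1) y (m + 2) (.and (selfFm m y)
    (.ex (.and (.eq (.var (y + 1)) (par m (.const 1))) (pruneFm h m y))))
    (.add (par m (.const 1)) (.const 1)))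
  (.seq (fill (h + 1) y (.and (farFm m y) (pruneFm h m y)))
  (.seq (pB (y + 2))
    (mapCol (h + 1) y (m + 2) (farFm m y) (.read (y + 3) (.var y) (.const 0)))))))))

/-- The input lists, the parameters, the best coloring and the loop variables have names below `y`.
They survive the first call, so the pruned lists can be computed again for the second one. -/
theorem combineProg_tri {pA pB : ℕ → Prog} {KA KB : Inst → (ℕ → ℕ → Prop) → Prop}
    (hA : Solver H h pA KA) (hB : Solver H h pB KB) {m y : ℕ} (hm : 3 ≤ m) (hy : m + 4 ≤ y) :
    Tri (combineProg h pA pB m y) fun s s' => Keep m y s s' ∧ ∀ I, Env H I s →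
      ∃ φA φB, Sol H KA I (restrict (I.G.Adj (col s (m + 3) 0))
        (pruneBy H h I.G (col s (m + 3)) (lists h s m))) φA ∧
      Sol H KB I (restrict (fun v => v ≠ col s (m + 3) 0 ∧ ¬ I.G.Adj (col s (m + 3) 0) v)
        (pruneBy H h I.G (col s (m + 3)) (lists h s m))) φB ∧
      ∀ v < I.n, col s' (m + 2) v = combine I.G (col s (m + 3) 0) (col s (m + 3) 1)
        (pruneBy H h I.G (col s (m + 3)) (lists h s m)) φA φB v := by
  classical
  have bnear : ∀ k l, 0 ≠ k → m + 3 ≠ k → y < l → (nearFm m y).Below k l := fun k l h0 h3 hl => by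
    simp [nearFm, par, Fm.adj, Fm.Below, Test.Below, IExp.Below, h0, h3, hl]
  have bself : ∀ k l, m + 3 ≠ k → y < l → (selfFm m y).Below k l := fun k l h3 hl => by
    simp [selfFm, par, Fm.eq, Fm.Below, Test.Below, IExp.Below, h3, hl]
  have bprune : ∀ k, k = m + 2 ∨ k = y + 2 → (pruneFm h m y).Below k (y + 2) := fun k hk =>
    below_pruneFm (by omega) (by omega) (by omega) (by omega) (by omega)
  have t1 := fill_tri (b := h + 1) (m := y) (f := .and (nearFm m y) (pruneFm h m y)) (by omega)
    ⟨bnear _ _ (by omega) (by omega) (by omega), bprune _ (.inr rfl)⟩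
  have t3 := mapCol_tri (b := h + 1) (m := y) (k := m + 2) (f := nearFm m y)
    (e := .read (y + 3) (.var y) (.const 0)) (by omega)
    (bnear _ _ (by omega) (by omega) (by omega)) ⟨by omega, Nat.lt_succ_self y, trivial⟩
  have t4 := mapCol_tri (b := h + 1) (m := y) (k := m + 2) (f := selfFm m y)
    (e := .const 0) (by omega) (bself _ _ (by omega) (by omega)) trivial
  -- The existential quantifier merely loads the color `a` into the variable `y + 1`, where
  -- `pruneFm` expects it.
  have t5 := mapCol_tri (b := h + 1) (m := y) (k := m + 2) (f := .and (selfFm m y)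
    (.ex (.and (.eq (.var (y + 1)) (par m (.const 1))) (pruneFm h m y))))
    (e := .add (par m (.const 1)) (.const 1)) (by omega)
    ⟨bself _ _ (by omega) (by omega), by simp [Fm.eq, Fm.Below, Test.Below, IExp.Below, par],
      bprune _ (.inl rfl)⟩ (by simp [IExp.Below, par])
  have t6 := fill_tri (b := h + 1) (m := y) (f := .and (farFm m y) (pruneFm h m y)) (by omega)
    ⟨⟨bself _ _ (by omega) (by omega), bnear _ _ (by omega) (by omega) (by omega)⟩,
      bprune _ (.inr rfl)⟩
  have t8 := mapCol_tri (b := h + 1) (m := y) (k := m + 2) (f := farFm m y)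
    (e := .read (y + 3) (.var y) (.const 0)) (by omega)
    ⟨bself _ _ (by omega) (by omega), bnear _ _ (by omega) (by omega) (by omega)⟩
    ⟨by omega, Nat.lt_succ_self y, trivial⟩
  refine (t1.seq ((hA (y + 2) (by omega)).seq (t3.seq (t4.seq (t5.seq (t6.seq
    ((hB (y + 2) (by omega)).seq t8))))))).mono ?_
  rintro s s' - ⟨s₁, -, ⟨u1, f1⟩, s₂, -, ⟨a2, f2⟩, s₃, -, ⟨u3, f3⟩, s₄, -, ⟨u4, f4⟩,
    s₅, -, ⟨u5, f5⟩, s₆, -, ⟨u6, f6⟩, s₇, -, ⟨a7, f7⟩, u8, f8⟩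
  have k0 : Keep m y s s := (Agree.refl y s).keep le_rfl
  have k1 : Keep m y s s₁ := u1.keep (.inr (by omega))
  have k2 : Keep m y s s₂ := k1.trans (a2.keep (by omega))
  have k3 : Keep m y s s₃ := k2.trans (u3.keep (.inl rfl))
  have k4 : Keep m y s s₄ := k3.trans (u4.keep (.inl rfl))
  have k5 : Keep m y s s₅ := k4.trans (u5.keep (.inl rfl))
  have k6 : Keep m y s s₆ := k5.trans (u6.keep (.inr (by omega)))
  have k7 : Keep m y s s₇ := k6.trans (a7.keep (by omega))
  have k8 : Keep m y s s' := k7.trans (u8.keep (.inl rfl))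
  refine ⟨k8, fun I hI => ?_⟩
  set F := col s (m + 3) with hF
  set P := pruneBy H h I.G F (lists h s m) with hP
  have near : ∀ t l, Keep m y s t →
      ((nearFm m y).holds (h + 1) l t ↔ I.G.Adj (F 0) (t.ivar y)) := by
    intro t l ht
    have e : t.iarr (m + 3) 0 0 = F 0 := congrFun (ht.col (by omega) (by omega)) 0
    simp [nearFm, par, IExp.eval, e, (ht.env hm hy hI).adj]
  have self : ∀ t l, Keep m y s t → ((selfFm m y).holds (h + 1) l t ↔ t.ivar y = F 0) := by
    intro t l ht
    have e : t.iarr (m + 3) 0 0 = F 0 := congrFun (ht.col (by omega) (by omega)) 0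
    simp [selfFm, par, IExp.eval, e]
  have far : ∀ t l, Keep m y s t →
      ((farFm m y).holds (h + 1) l t ↔ t.ivar y ≠ F 0 ∧ ¬ I.G.Adj (F 0) (t.ivar y)) := fun t l ht =>
    and_congr (not_congr (self t l ht)) (not_congr (near t l ht))
  have kset : ∀ t v, Keep m y s t → Keep m y s (t.setI y v) := fun t v ht =>
    ht.trans (((Agree.refl y t).setI le_rfl v).keep le_rfl)
  have kset' : ∀ t v c, Keep m y s t → Keep m y s ((t.setI y v).setI (y + 1) c) := fun t v c ht =>
    ht.trans ((((Agree.refl y t).setI le_rfl v).setI (Nat.le_succ y) c).keep le_rfl)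
  have ey : ∀ (t : State) v c, ((t.setI y v).setI (y + 1) c).ivar y = v := fun t v c => by
    rw [State.setI_ivar_of_ne _ _ (by omega), State.setI_ivar_self]
  have pr : ∀ t v c, Keep m y s t →
      ((pruneFm h m y).holds (h + 1) (y + 2) ((t.setI y v).setI (y + 1) c) ↔ P v c) := by
    intro t v c ht
    have ht' := kset' t v c ht
    rw [holds_pruneFm (ht'.env hm hy hI), ht'.col (by omega) (by omega), ht'.lists hy,
      State.setI_ivar_self, ey]
  have hPh : ∀ v c, P v c → v < I.n ∧ c < h := fun v c hc => ⟨hI.n ▸ hc.1.1, hc.1.2.1⟩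
  have hlists : ∀ (t : State) (Q : ℕ → Prop), Env H I t → (∀ v < I.n, ∀ c < h,
      (1 ≤ t.iarr (y + 2) v c ↔ Q v ∧ P v c)) → lists h t (y + 2) = restrict Q P := by
    intro t Q ht hQ
    funext v c
    refine propext ⟨fun ⟨h1, h2, h3⟩ => (hQ v (ht.n ▸ h1) c h2).mp h3, fun hvc => ?_⟩
    obtain ⟨h1, h2⟩ := hPh v c hvc.2
    exact ⟨by rwa [ht.n], h2, (hQ v h1 c h2).mpr hvc⟩
  have bound : ∀ t, Keep m y s t → t.ivar 0 = I.n := fun t ht => (ht.env hm hy hI).n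
  have l1 : lists h s₁ (y + 2) = restrict (I.G.Adj (F 0)) P :=
    hlists s₁ _ (k1.env hm hy hI) fun v hv c hc => by
      rw [f1 v (by rw [hI.n]; omega) c (by rw [hI.n]; omega), Fm.holds_and,
        near _ _ (kset' s v c k0), ey, pr s v c k0]
  have l6 : lists h s₆ (y + 2) = restrict (fun v => v ≠ F 0 ∧ ¬ I.G.Adj (F 0) v) P :=
    hlists s₆ _ (k6.env hm hy hI) fun v hv c hc => by
      rw [f6 v (by rw [bound _ k5]; omega) c (by rw [bound _ k5]; omega), Fm.holds_and,
        far _ _ (kset' s₅ v c k5), ey, pr s₅ v c k5]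
  refine ⟨col s₂ (y + 3), col s₇ (y + 3), l1 ▸ f2 I (k1.env hm hy hI),
    l6 ▸ f7 I (k6.env hm hy hI), fun v hv => ?_⟩
  have e3 := f3 v (by rw [bound _ k2]; omega)
  have e4 := f4 v (by rw [bound _ k3]; omega)
  have e5 := f5 v (by rw [bound _ k4]; omega)
  have e8 := f8 v (by rw [bound _ k7]; omega)
  have i67 : s₇.iarr (m + 2) = s₅.iarr (m + 2) :=
    ((a7 (m + 2) (by omega)).2.2.1).trans (u6.iarr _ (by omega))
  have e1 : s₄.iarr (m + 3) 1 0 = F 1 := congrFun (k4.col (by omega) (by omega)) 1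
  simp only [near _ _ (kset _ _ k2), State.setI_ivar_self, IExp.eval, State.setI_iarr] at e3
  simp only [self _ _ (kset _ _ k3), State.setI_ivar_self, IExp.eval] at e4
  simp only [Fm.holds_and, Fm.holds_ex, Fm.holds_eq, pr _ _ _ k4, self _ _ (kset _ _ k4), par, e1,
    State.setI_ivar_self, IExp.eval, State.setI_iarr] at e5
  simp only [far _ _ (kset _ _ k7), State.setI_ivar_self, IExp.eval, State.setI_iarr, i67] at e8
  have hex : (∃ k < (s₄.setI y v).ivar 0 + (h + 1), k = F 1 ∧ P v k) ↔ P v (F 1) := by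
    rw [bound _ (kset _ _ k4)]
    refine ⟨fun ⟨k, _, hk, hP⟩ => hk ▸ hP, fun hv => ⟨F 1, ?_, rfl, hv⟩⟩
    have := (hPh _ _ hv).2
    omega
  simp only [hex] at e5
  show s'.iarr (m + 2) v 0 = _
  unfold combine
  by_cases hn : I.G.Adj (F 0) v
  · have hne : v ≠ F 0 := fun e => hn.ne e.symm
    rw [if_pos hn, e8, if_neg (fun h => h.2 hn), e5, if_neg (fun h => hne h.1), e4, if_neg hne, e3,
      if_pos hn]
    rfl
  · by_cases hs : v = F 0
    · rw [if_neg hn, if_pos hs, e8, if_neg (fun h => h.1 hs), e5, e4, if_pos hs, ← hs]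
      simp
    · rw [if_neg hn, if_neg hs, e8, if_pos ⟨hs, hn⟩]
      rfl

end PartialColoring

/-! ### Optimizing over the choices -/

namespace PartialColoring

open RealRAM

variable {H : SimpleGraph ℕ} {h : ℕ} {I : Inst}

/-- The coloring in column `0` of the array `m + 2` replaces the best coloring so far, in the array
`m + 1` and with the revenue in the real variable `m + 1`, if it is better. -/
def improve (h m y : ℕ) : Prog :=
  .seq (sumCol (h + 1) y (m + 2) (m + 2))
    (.cond (.neg (.rle (.var (m + 2)) (.var (m + 1))))
      (.seq (.setR (m + 1) (.var (m + 2)))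
        (mapCol (h + 1) y (m + 1) .tt (.read (m + 2) (.var y) (.const 0)))) .skip)

/-- The index `k` tells which of the two colorings is kept, so validity is inherited, while the best
revenue never decreases. -/
theorem improve_tri {m y : ℕ} (hy : m + 4 ≤ y) : Tri (improve h m y) fun s s' =>
    Agree (m + 1) s s' ∧ (∀ x < y, s'.ivar x = s.ivar x) ∧ s'.iarr (m + 3) = s.iarr (m + 3) ∧
    s.rvar (m + 1) ≤ s'.rvar (m + 1) ∧ ∀ I : Inst, s.ivar 0 = I.n → s.rarr 0 = I.r → ∃ k, (k = m + 1 ∨ k = m + 2) ∧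
      (∀ v < I.n, col s' (m + 1) v = col s k v) ∧
      (s.rvar (m + 1) = total I (col s (m + 1)) →
        s'.rvar (m + 1) = total I (col s' (m + 1)) ∧
          total I (col s (m + 2)) ≤ s'.rvar (m + 1)) := by
  have t1 := sumCol_tri (b := h + 1) (m := y) (k := m + 2) (ρ := m + 2) (by omega)
  have t2 := mapCol_tri (b := h + 1) (m := y) (k := m + 1) (f := .tt)
    (e := .read (m + 2) (.var y) (.const 0)) (by omega)
    (by simp [Fm.tt, Fm.Below, Test.Below, IExp.Below])
    ⟨by omega, Nat.lt_succ_self y, trivial⟩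
  refine (t1.seq (Tri.cond (.neg (.rle (.var (m + 2)) (.var (m + 1))))
    ((Tri.setR (m + 1) (.var (m + 2))).seq t2) Tri.skip)).mono ?_
  rintro s s' - ⟨s₁, h0, ⟨g1, g2, g3, g4, g5⟩, hs'⟩
  have a1 : Agree (m + 1) s s₁ := fun k hk => ⟨g1 k (by omega), g4 k (by omega), by rw [g2],
    by rw [g3]⟩
  have r1 : s₁.rvar (m + 1) = s.rvar (m + 1) := g4 _ (by omega)
  have sum : ∀ I : Inst, s.ivar 0 = I.n → s.rarr 0 = I.r →
      s₁.rvar (m + 2) = total I (col s (m + 2)) := fun I hn hr => by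
    rw [g5, hn, hr]
    rfl
  rcases hs' with ⟨hb, s₂, -, rfl, u, f⟩ | ⟨hb, rfl⟩
  · have hr' : s'.rvar (m + 1) = s₁.rvar (m + 2) := by
      rw [u.rvar]
      exact Function.update_self _ _ _
    simp only [Test.holds, RExp.eval, not_le, r1] at hb
    refine ⟨a1.trans fun k hk => ⟨u.ivar k (by omega), ?_, u.iarr k (by omega), by rw [u.rarr]⟩,
      fun x hx => (u.ivar x hx).trans (g1 x hx),
      (u.iarr _ (by omega)).trans (congrFun g2 _), hr' ▸ hb.le, fun I hn hr => ?_⟩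
    · rw [u.rvar]
      exact Function.update_of_ne (by omega) _ _
    · have hc : ∀ v < I.n, col s' (m + 1) v = col s (m + 2) v := fun v hv => by
        simpa [IExp.eval, g2, col] using f v (by show v < s₁.ivar 0 + _; rw [h0]; omega)
      refine ⟨m + 2, .inr rfl, hc, fun ht => ?_⟩
      rw [hr', total_congr hc, sum I hn hr]
      exact ⟨rfl, le_rfl⟩
  · simp only [Test.holds, RExp.eval, not_not, r1] at hb
    refine ⟨a1, g1, congrFun g2 _, r1.ge, fun I hn hr => ⟨m + 1, .inl rfl, fun v _ => ?_,
      fun ht => ?_⟩⟩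
    · simp only [col, g2]
    · refine ⟨?_, sum I hn hr ▸ r1 ▸ hb⟩
      rw [r1, ht]
      unfold col
      rw [g2]

/-- The program that tries all choices of the parameters. -/
def stepProg (h : ℕ) (pA pB : ℕ → Prog) (m : ℕ) : Prog :=
  .seq (mapCol (h + 1) (m + 4) (m + 1) .tt (.const 0)) (.seq (.setR (m + 1) .zero)
    (tupleLoop (h + 1) (m + 4) (m + 3)
      (.seq (combineProg h pA pB m (m + 4 + (h + h + 2))) (improve h m (m + 4 + (h + h + 2))))
      (h + h + 2)))

/-- Parameters as a sequence. -/
theorem exists_pruneBy_eq (n u a : ℕ) (hu : u < n) (ha : a ≤ h) (p q : ℕ → ℕ) (hp : ∀ j, p j ≤ n)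
    (hq : ∀ j, q j ≤ n) : ∃ f : ℕ → ℕ, (∀ i, f i < n + (h + 1)) ∧ f 0 = u ∧ f 1 = a ∧
      ∀ G L, pruneBy H h G f L = prune H h G u a p q L := by
  refine ⟨fun i => if i = 0 then u else if i = 1 then a else if i % 2 = 0 then p ((i - 2) / 2)
    else q ((i - 3) / 2), fun i => ?_, rfl, rfl, fun G L => ?_⟩
  · have h1 := hp ((i - 2) / 2)
    have h2 := hq ((i - 3) / 2)
    dsimp only
    split_ifs <;> omega
  · unfold pruneBy
    congr 1 <;> funext j <;> dsimp only
    · rw [if_neg (by omega), if_neg (by omega), if_pos (by omega)]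
      congr 1
      omega
    · rw [if_neg (by omega), if_neg (by omega), if_neg (by omega)]
      congr 1
      omega

theorem col_write {s : State} {k m : ℕ} (hk : m ≠ k) (i j x : ℕ) :
    col { s with iarr := update3 s.iarr k i j x } m = col s m := by
  funext v
  show update3 s.iarr k i j x m v 0 = s.iarr m v 0
  rw [update3_of_ne hk]

/-- Validity is an invariant because every tuple of parameters gives a valid coloring. For each
competitor some tuple gives a coloring that is at least as good, and the best revenue only grows. -/
theorem Solver.step {pA pB : ℕ → Prog} {KA KB : Inst → (ℕ → ℕ → Prop) → Prop}
    (hA : Solver H h pA KA) (hB : Solver H h pB KB) :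
    Solver H h (stepProg h pA pB) (StepClass H KA KB) := by
  intro m hm
  have t0 := mapCol_tri (b := h + 1) (m := m + 4) (k := m + 1) (f := .tt) (e := .const 0) (by omega)
    (by simp [Fm.tt, Fm.Below, Test.Below, IExp.Below]) (by simp [IExp.Below])
  have hL : ∀ (g : State) v c, lists h g m v c → c < h := fun g v c hc => hc.2.1
  have body := (combineProg_tri hA hB hm (y := m + 4 + (h + h + 2)) (by omega)).seq
    (improve_tri (h := h) (m := m) (y := m + 4 + (h + h + 2)) (by omega))
  have loop := tupleLoop_tri (b := h + 1) (x := m + 4) (k := m + 3) (K := h + h + 2) (by omega)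
    -- The initial state, an instance and a competing coloring: a single run has to beat all
    -- competitors.
    (γ := State × Inst × (ℕ → ℕ))
    (fun g s => Agree (m + 1) g.1 s ∧ (Env H g.2.1 g.1 →
      Valid H g.2.1 (lists h g.1 m) (col s (m + 1)) ∧
        s.rvar (m + 1) = total g.2.1 (col s (m + 1))))
    (fun g s => total g.2.1 g.2.2 ≤ s.rvar (m + 1))
    (fun g f => Env H g.2.1 g.1 ∧ ∀ φA φB, Sol H KA g.2.1 (restrict (g.2.1.G.Adj (f 0))
        (pruneBy H h g.2.1.G f (lists h g.1 m))) φA →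
      Sol H KB g.2.1 (restrict (fun v => v ≠ f 0 ∧ ¬ g.2.1.G.Adj (f 0) v)
        (pruneBy H h g.2.1.G f (lists h g.1 m))) φB →
      total g.2.1 g.2.2 ≤ total g.2.1 (combine g.2.1.G (f 0) (f 1)
        (pruneBy H h g.2.1.G f (lists h g.1 m)) φA φB))
    (by
      intro g f f' hf hG
      rwa [pruneBy_congr (hL g.1) hf, hf 0 (by omega), hf 1 (by omega)] at hG)
    (fun g s j v _ hI => ⟨⟨hI.1.setI (x := m + 4 + j) (by omega) v, hI.2⟩, id⟩)
    (fun g s i v hI => ⟨⟨hI.1.trans ((Upd.write (m + 1) (m + 3) s i 0 v).agree le_rfl (by omega)),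
      fun he => by
        rw [col_write (by omega)]
        exact hI.2 he⟩, id⟩)
    (body.mono (by
      rintro s s' - ⟨s₁, h0, ⟨k1, c1⟩, a2, v2, w2, r2, i2⟩
      refine ⟨fun z hz => (v2 z hz).trans (k1.ivar z hz),
        w2.trans (k1.iarr _ (by omega) (by omega)), ?_⟩
      rintro ⟨g, I, ψ⟩ ⟨b1, b2⟩
      have ks : Agree (m + 1) s s₁ := fun k hk => ⟨k1.ivar k (by omega), k1.rvar k (by omega),
        k1.iarr k (by omega) (by omega), k1.rarr k (by omega)⟩
      have hr1 : s₁.rvar (m + 1) = s.rvar (m + 1) := k1.rvar _ (by omega)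
      have hc1 : col s₁ (m + 1) = col s (m + 1) := k1.col (by omega) (by omega)
      rw [hr1] at r2
      dsimp only at b1 b2 ⊢
      refine ⟨⟨(b1.trans ks).trans a2, fun he => ?_⟩, fun hd => hd.trans r2, fun ⟨he, hG⟩ => ?_⟩
      all_goals
        have hs := he.agree (by omega) b1
        have hs₁ := hs.agree (by omega) ks
        have hls : lists h s m = lists h g m :=
          lists_congr (b1 0 (by omega)).1 (b1 m (by omega)).2.2.1
        obtain ⟨φA, φB, sA, sB, hcomb⟩ := c1 I hs
        obtain ⟨k, hk, hc, ht⟩ := i2 I hs₁.n hs₁.rev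
        rw [hls] at sA sB hcomb
      · refine ⟨Valid.congr (φ := col s₁ k) ?_ fun v hv => (hc v hv).symm, (ht ?_).1⟩
        · rcases hk with rfl | rfl
          · exact hc1 ▸ (b2 he).1
          · exact (Valid.combine (hL g) sA.1 sB.1).congr fun v hv => (hcomb v hv).symm
        · rw [hr1, hc1, (b2 he).2]
      · refine (hG φA φB sA sB).trans (le_of_eq_of_le ?_ (ht ?_).2)
        · exact total_congr fun v hv => (hcomb v hv).symm
        · rw [hr1, hc1, (b2 he).2])) (h + h + 2) le_rfl
  refine (t0.seq ((Tri.setR (m + 1) .zero).seq loop)).mono ?_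
  rintro s s' - ⟨s₁, h01, ⟨u, f⟩, s₂, h02, hs₂, -, -, hinv⟩
  have e1 : s₂.iarr = s₁.iarr := by rw [hs₂]
  have ag : Agree (m + 1) s s₂ := by
    refine (u.agree (by omega) le_rfl).trans fun k hk => ?_
    rw [hs₂]
    exact ⟨rfl, Function.update_of_ne (by omega) _ _, rfl, rfl⟩
  have r0 : s₂.rvar (m + 1) = 0 := by
    rw [hs₂]
    exact Function.update_self _ _ _
  have inv : ∀ I, Agree (m + 1) s s₂ ∧ (Env H I s → Valid H I (lists h s m) (col s₂ (m + 1)) ∧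
      s₂.rvar (m + 1) = total I (col s₂ (m + 1))) := by
    intro I
    refine ⟨ag, fun hI => ?_⟩
    have hz : ∀ v < I.n, col s₂ (m + 1) v = 0 := fun v hv => by
      simpa [IExp.eval, col, e1] using f v (by rw [hI.n]; omega)
    exact ⟨valid_zero hz, by rw [r0, total_zero hz]⟩
  -- The frame condition is required even if the state stores no instance, so it is read off with
  -- the empty instance.
  refine ⟨(hinv (s, ⟨0, ⊥, fun _ _ => 0, fun _ _ h => h.elim, fun _ _ _ _ _ h => h.elim⟩, 0)
    (inv _)).1.1, fun I hI => ⟨((hinv (s, I, 0) (inv I)).1.2 hI).1, fun hK ψ hψ => ?_⟩⟩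
  obtain ⟨i1, i2, i3⟩ := hinv (s, I, ψ) (inv I)
  rw [← (i1.2 hI).2]
  by_cases hne : ∃ v < I.n, ψ v ≠ 0
  · obtain ⟨u, hu, a, ha, p, q, hp, hq, hopt⟩ := hK.exists_params (hL s) hψ hne
    obtain ⟨f, hf, rfl, rfl, hfp⟩ := exists_pruneBy_eq (H := H) I.n u a hu ha p q hp hq
    -- Beyond the enumerated entries the tuple has to agree with what is in memory.
    let f' : ℕ → ℕ := fun i => if i < h + h + 2 then f i else s₂.iarr (m + 3) i 0
    have hff : ∀ i < h + h + 2, f i = f' i := fun i hi => (if_pos hi).symm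
    refine i3 f' (fun i hi => ?_) (fun i hi => if_neg (by omega)) ⟨hI, ?_⟩
    · rw [← hff i hi, (ag 0 (by omega)).1, hI.n]
      exact hf i
    · dsimp only
      rw [← pruneBy_congr (hL s) hff, ← hff 0 (by omega), ← hff 1 (by omega), hfp]
      exact hopt
  -- The empty competitor earns `0`, as does the initial coloring.
  · push Not at hne
    refine i2 ?_
    simp only [r0, total_zero hne, le_refl]

end PartialColoring

/-! ### Recursion on the forbidden graph -/

namespace PartialColoring

open RealRAM

variable {H : SimpleGraph ℕ} {h : ℕ} {I : Inst} {L L' : ℕ → ℕ → Prop}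

/-- All lists contain only colors from a set of size `c`. -/
def Few (c : ℕ) (I : Inst) (L : ℕ → ℕ → Prop) : Prop :=
  (∃ R : Finset ℕ, R.card ≤ c ∧ ∀ v a, L v a → a ∈ R) ∧ ∀ v a, L v a → v < I.n

/-- No component of the support contains the word `w`, and there are at most `c` colors. -/
def Free (w : List Bool) (c : ℕ) (I : Inst) (L : ℕ → ℕ → Prop) : Prop :=
  (∀ r ∈ supp L, ¬ Contains I.G w {v | Link I.G (supp L) r v}) ∧ Few c I L

/-- The support is connected and does not contain the word `w`, and there are at most `c` colors. -/
def FreeConn (w : List Bool) (c : ℕ) (I : Inst) (L : ℕ → ℕ → Prop) : Prop :=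
  (∀ a ∈ supp L, ∀ b ∈ supp L, Link I.G (supp L) a b) ∧ ¬ Contains I.G w (supp L) ∧ Few c I L

theorem Few.mono {c : ℕ} (hL : Few c I L) (hsub : ∀ v a, L' v a → L v a) : Few c I L' := by
  obtain ⟨⟨R, hR, hc⟩, hn⟩ := hL
  exact ⟨⟨R, hR, fun v a ha => hc v a (hsub v a ha)⟩, fun v a ha => hn v a (hsub v a ha)⟩

theorem Free.of_not_contains {w : List Bool} {c : ℕ} {X : Set ℕ} (hX : supp L ⊆ X)
    (hw : ¬ Contains I.G w X) (hL : Few c I L) : Free w c I L :=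
  ⟨fun _ _ h => hw (h.mono fun _ hv => hX hv.2.1), hL⟩

/-- Links between vertices of a component stay inside it, so they survive in the smaller support. -/
theorem Free.componentsIn {w : List Bool} {c : ℕ} (hL : Free w c I L) :
    ComponentsIn (FreeConn w c) I L := by
  intro r hr
  have hs : supp (component I.G L r) = {v | Link I.G (supp L) r v} := by
    ext v
    exact ⟨fun ⟨a, ha⟩ => ha.1, fun hv => hv.2.1.imp fun a ha => ⟨hv, ha⟩⟩
  refine ⟨?_, hs ▸ hL.1 r hr, hL.2.mono fun v a ha => ha.2⟩
  rw [hs]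
  rintro a ha b hb
  obtain ⟨-, -, x, hx, y, hy, h1, h2, h3⟩ := ha.symm.trans I.noInducedP5 hb
  have hrx : Link I.G (supp L) r x := Link.step I.noInducedP5 ha hx h1
  exact ⟨ha, hb, x, hrx, y, hrx.step I.noInducedP5 hy h2, h1, h2, h3⟩

/-- The center is a vertex colored by `ψ`. Its color disappears from the lists of its neighbors, and
the first letter of the word is used up on its non-neighbors. -/
theorem FreeConn.stepClass_false {w : List Bool} {c : ℕ} (hL : FreeConn (false :: w) (c + 1) I L) :
    StepClass H (Free (false :: w) c) (Free w (c + 1)) I L := by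
  rintro ψ hψ ⟨u, hu, hu0⟩
  obtain ⟨a, ha⟩ := Nat.exists_eq_succ_of_ne_zero hu0
  have hua := hψ.1 u hu a ha
  obtain ⟨-, hw, hF⟩ := hL
  refine ⟨u, hu, fun L' hL' hne => ⟨?_, ?_⟩⟩
  · refine .of_not_contains (X := supp L) (fun v ⟨b, hb⟩ => ⟨b, hL' v b hb.2⟩) hw ?_
    obtain ⟨⟨R, hR, hc⟩, hn⟩ := hF
    refine ⟨⟨R.erase a, ?_, fun v b hb => Finset.mem_erase.mpr ⟨fun hba => hne v b hb.1 hb.2 ?_,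
      hc v b (hL' v b hb.2)⟩⟩, fun v b hb => hn v b (hL' v b hb.2)⟩
    · rw [Finset.card_erase_of_mem (hc u a hua)]
      omega
    · rw [hba]
      exact ha
  · exact .of_not_contains (X := away I.G u (supp L))
      (fun v ⟨b, hb⟩ => ⟨⟨b, hL' v b hb.2⟩, hb.1⟩) (fun h => hw ⟨u, ⟨a, hua⟩, h⟩)
      (hF.mono fun v b hb => hL' v b hb.2)

/-- The centers are the two monitors, whether or not `ψ` colors them. Every part that remains lies,
component by component, in the neighborhood of a vertex, where the first letter is used up. -/
theorem FreeConn.stepClass_true {w : List Bool} {c : ℕ} (hL : FreeConn (true :: w) c I L) :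
    StepClass H (Free w c) (StepClass H (Free w c) (Free w c)) I L := by
  rintro ψ hψ ⟨v, hv, hv0⟩
  obtain ⟨a, ha⟩ := Nat.exists_eq_succ_of_ne_zero hv0
  obtain ⟨hconn, hw, hF⟩ := hL
  have hlt : ∀ v ∈ supp L, v < I.n := fun v ⟨b, hb⟩ => hF.2 v b hb
  obtain ⟨d, hd, s, hs, hds⟩ := exists_monitor I.noInducedP5
    ((Set.finite_Iio I.n).subset hlt) hconn ⟨a, hψ.1 v hv a ha⟩
  have hw' : ∀ u ∈ supp L, ¬ Contains I.G w {x | x ∈ supp L ∧ I.G.Adj u x} := fun u hu h =>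
    hw ⟨u, hu, h⟩
  refine ⟨d, hlt d hd, fun L₁ h₁ _ => ⟨?_, ?_⟩⟩
  · exact .of_not_contains (X := {x | x ∈ supp L ∧ I.G.Adj d x})
      (fun v ⟨b, hb⟩ => ⟨⟨b, h₁ v b hb.2⟩, hb.1⟩) (hw' d hd)
      (hF.mono fun v b hb => h₁ v b hb.2)
  rintro ψ' - -
  -- `s` may have been separated off together with the neighborhood of `d`; a center needs no
  -- nonempty list.
  refine ⟨s, hlt s hs, fun L₂ h₂ _ => ⟨?_, ?_, ?_⟩⟩
  · exact .of_not_contains (X := {x | x ∈ supp L ∧ I.G.Adj s x})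
      (fun v ⟨b, hb⟩ => ⟨⟨b, h₁ v b (h₂ v b hb.2).2⟩, hb.1⟩) (hw' s hs)
      (hF.mono fun v b hb => h₁ v b (h₂ v b hb.2).2)
  · set L₃ := restrict (fun v => v ≠ s ∧ ¬ I.G.Adj s v) L₂
    have hsub : supp L₃ ⊆ away I.G s (away I.G d (supp L)) := fun v ⟨b, hb⟩ =>
      ⟨⟨⟨b, h₁ v b (h₂ v b hb.2).2⟩, (h₂ v b hb.2).1⟩, hb.1⟩
    intro r hr hcon
    obtain ⟨x, hx, hadj⟩ := hds r (hsub hr)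
    exact hw' x hx (hcon.mono fun y hy => ⟨(hsub hy.2.1).1.1, hadj y (hy.mono hsub)⟩)
  · exact hF.mono fun v b hb => h₁ v b (h₂ v b hb.2).2

/-- Induction on the word, with an inner induction on the number of colors for the letter `false`.
The steps are proved for connected supports but leave disconnected ones, so the program for
components is put in between. -/
theorem exists_solver_free (H : SimpleGraph ℕ) (h : ℕ) (w : List Bool) (c : ℕ) :
    ∃ p, Solver H h p (Free w c) := by
  have base : ∀ {K : Inst → (ℕ → ℕ → Prop) → Prop}, (∀ I L, K I L → supp L = ∅) →
      ∃ p, Solver H h p K := fun hK =>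
    let ⟨p, hp⟩ := exists_solver_empty H h
    ⟨p, hp.mono hK⟩
  have comp : ∀ {w c}, (∃ p, Solver H h p (FreeConn w c)) → ∃ p, Solver H h p (Free w c) := by
    rintro w c ⟨p, hp⟩
    obtain ⟨p', hp'⟩ := hp.components
    exact ⟨p', hp'.mono fun I L hL => hL.componentsIn⟩
  induction w generalizing c with
  | nil => exact base fun I L hL => Set.eq_empty_iff_forall_notMem.mpr fun r hr => hL.1 r hr trivial
  | cons b w ih =>
    cases b
    · induction c with
      | zero =>
        refine base fun I L ⟨_, ⟨R, hR, hc⟩, _⟩ => Set.eq_empty_iff_forall_notMem.mpr ?_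
        rintro r ⟨a, ha⟩
        rw [Nat.le_zero, Finset.card_eq_zero] at hR
        simpa [hR] using hc r a ha
      | succ c ihc =>
        obtain ⟨pA, hA⟩ := ihc
        obtain ⟨pB, hB⟩ := ih (c + 1)
        exact comp ⟨_, (hA.step hB).mono fun I L hL => hL.stepClass_false⟩
    · obtain ⟨p, hp⟩ := ih c
      exact comp ⟨_, (hp.step (hp.step hp)).mono fun I L hL => hL.stepClass_true⟩

/-! ### Instances from graphs on `Fin n` -/

/-- Distinctness of the five vertices follows from the pattern of adjacencies, which is why
`NoInducedP5` does not ask for it. -/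
theorem NoInducedP5.of_indFree {V : Type*} {G : SimpleGraph V}
    (hG : IndFree (SimpleGraph.pathGraph 5) G) : NoInducedP5 G := by
  intro a b c d e ab bc cd de ac ad ae bd be ce
  refine hG ⟨⟨⟨![a, b, c, d, e], ?_⟩, ?_⟩⟩
  · have h1 : a ≠ c := by rintro rfl; exact ad cd
    have h2 : a ≠ d := by rintro rfl; exact ae de
    have h3 : a ≠ e := by rintro rfl; exact ad de.symm
    have h4 : b ≠ d := by rintro rfl; exact be de
    have h5 : b ≠ e := by rintro rfl; exact ae ab
    have h6 : c ≠ e := by rintro rfl; exact be bc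
    intro i j hij
    fin_cases i <;> fin_cases j <;>
      simp_all [ab.ne, bc.ne, cd.ne, de.ne, ab.ne', bc.ne', cd.ne', de.ne', eq_comm]
  · intro i j
    show G.Adj (![a, b, c, d, e] i) (![a, b, c, d, e] j) ↔ _
    rw [SimpleGraph.pathGraph_adj]
    fin_cases i <;> fin_cases j <;> simp_all [G.adj_comm]

theorem NoInducedP5.map {V W : Type*} {G : SimpleGraph V} (hG : NoInducedP5 G) (f : V ↪ W) :
    NoInducedP5 (G.map f) := by
  rintro _ _ _ _ _ ⟨-, a, b, ab, rfl, rfl⟩ ⟨-, b', c, bc, hb, rfl⟩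
    ⟨-, c', d, cd, hc, rfl⟩ ⟨-, d', e, de, hd, rfl⟩
  obtain rfl := f.injective hb
  obtain rfl := f.injective hc
  obtain rfl := f.injective hd
  simp only [SimpleGraph.map_adj_apply]
  exact hG _ _ _ _ _ ab bc cd de

theorem map_val_adj {n : ℕ} {G : SimpleGraph (Fin n)} {u v : ℕ} :
    (G.map Fin.valEmbedding).Adj u v ↔ ∃ (hu : u < n) (hv : v < n), G.Adj ⟨u, hu⟩ ⟨v, hv⟩ := by
  constructor
  · rintro ⟨-, a, b, hab, rfl, rfl⟩
    exact ⟨a.2, b.2, hab⟩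
  · rintro ⟨hu, hv, huv⟩
    exact (SimpleGraph.map_adj ..).mpr ⟨_, _, huv, rfl, rfl⟩

/-- The instance on the natural numbers. -/
noncomputable def ofFin {n h : ℕ} (G : SimpleGraph (Fin n)) (rev : Fin n → Fin h → ℝ)
    (hG : IndFree (SimpleGraph.pathGraph 5) G) : Inst where
  n := n
  G := G.map Fin.valEmbedding
  r := (inputState G rev).rarr 0
  lt_of_adj _ _ huv := (map_val_adj.mp huv).1
  noInducedP5 := (NoInducedP5.of_indFree hG).map _

section ofFin

variable {n : ℕ} {G : SimpleGraph (Fin n)} {rev : Fin n → Fin h → ℝ}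
  {hG : IndFree (SimpleGraph.pathGraph 5) G} {H₀ : SimpleGraph (Fin h)}
  {φ : Fin n → Option (Fin h)} {x : ℕ → ℕ}

theorem total_ofFin (hx : ∀ v : Fin n, x v = (φ v).elim 0 (fun c => (c : ℕ) + 1)) :
    total (ofFin G rev hG) x = revenue rev φ := by
  show ∑ v ∈ Finset.range n, gain ((inputState G rev).rarr 0) v (x v) = _
  rw [Finset.sum_range]
  refine Finset.sum_congr rfl fun v _ => ?_
  rw [hx v]
  cases φ v <;> simp [gain, inputState]

theorem valid_ofFin (hx : ∀ v : Fin n, x v = (φ v).elim 0 (fun c => (c : ℕ) + 1)) :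
    Valid (H₀.map Fin.valEmbedding) (ofFin G rev hG) (fun v c => v < n ∧ c < h) x ↔
      IsPartialColoring G H₀ φ := by
  have hc : ∀ (v : Fin n) (c : Fin h), φ v = some c → x v = c + 1 := fun v c hv => by
    simp [hx v, hv]
  have hc' : ∀ (v : Fin n) c, x v = c + 1 → ∃ hc : c < h, φ v = some ⟨c, hc⟩ := by
    intro v c hv
    rw [hx v] at hv
    cases hφ : φ v with
    | none => simp [hφ] at hv
    | some b =>
      simp only [hφ, Option.elim_some, Nat.add_right_cancel_iff] at hv
      subst hv
      exact ⟨b.2, rfl⟩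
  constructor
  · intro hv u v a b huv ha hb
    exact (SimpleGraph.map_adj_apply (f := Fin.valEmbedding)).mp (hv.2 u v a b
      ((SimpleGraph.map_adj_apply (f := Fin.valEmbedding)).mpr huv) (hc u a ha) (hc v b hb))
  · refine fun hφ => ⟨fun v hv c hvc => ⟨hv, (hc' ⟨v, hv⟩ c hvc).1⟩, ?_⟩
    intro u v a b huv ha hb
    obtain ⟨hu, hv, huv⟩ := map_val_adj.mp huv
    obtain ⟨_, ha⟩ := hc' ⟨u, hu⟩ a ha
    obtain ⟨_, hb⟩ := hc' ⟨v, hv⟩ b hb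
    exact map_val_adj.mpr ⟨_, _, hφ _ _ _ _ huv ha hb⟩

end ofFin

/-! ### Assembling the program -/

/-- Finitely many entries of the integer array `2` are set to `1`. -/
theorem exists_tri_table (S : Finset (ℕ × ℕ)) : ∃ p, Tri p fun s s' => (∀ m, Upd m 2 s s') ∧
    ∀ a b, 1 ≤ s'.iarr 2 a b ↔ (a, b) ∈ S ∨ 1 ≤ s.iarr 2 a b := by
  classical
  induction S using Finset.induction_on with
  | empty =>
    refine ⟨.skip, Tri.skip.mono ?_⟩
    rintro s _ - rfl
    exact ⟨fun m => ⟨fun _ _ => rfl, rfl, fun _ _ => rfl, rfl⟩, by simp⟩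
  | insert x S _ ih =>
    obtain ⟨p, hp⟩ := ih
    refine ⟨_, (hp.seq (Tri.writeI 2 (.const x.1) (.const x.2) (.const 1))).mono ?_⟩
    rintro s _ - ⟨s', -, ⟨h1, h2⟩, rfl⟩
    refine ⟨fun m => (h1 m).trans (.write _ _ _ _ _ _), fun a b => ?_⟩
    simp only [update3, IExp.eval, Finset.mem_insert, Prod.ext_iff, true_and, or_assoc, ← h2]
    split_ifs with hab <;> simp [hab]

end PartialColoring

open PartialColoring RealRAM in
theorem mainTheorem1 {U : Type*} [Finite U] (F : SimpleGraph U) (hF : IsThresholdGraph F)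
    {h : ℕ} (H : SimpleGraph (Fin h)) :
    MaxPartialColoringInPolyTime H
      (fun _ G => IndFree (SimpleGraph.pathGraph 5) G ∧ IndFree F G) := by
  classical
  obtain ⟨w, hw⟩ := exists_word_of_isThresholdGraph hF ℕ
  let H' := H.map Fin.valEmbedding
  obtain ⟨p, hp⟩ := exists_solver_free H' h w h
  obtain ⟨q, hq⟩ := exists_tri_table
    ((Finset.range h ×ˢ Finset.range h).filter fun x => H'.Adj x.1 x.2)
  have t1 := fill_tri (b := h + 1) (m := 1) (f := .tt) (by omega)
    (by simp [Fm.tt, Fm.Below, Test.Below, IExp.Below])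
  have t2 := mapCol_tri (b := 0) (m := 1) (k := 1) (f := .tt) (e := .read 4 (.var 1) (.const 0))
    (by omega) (by simp [Fm.tt, Fm.Below, Test.Below, IExp.Below]) (by simp [IExp.Below])
  obtain ⟨T, hT⟩ := hq.seq (t1.seq ((hp 3 le_rfl).seq t2))
  -- `H` is not part of the input, so the program writes its table into the array `2`. Then it sets
  -- the array `3` to full lists, solves into the array `4`, and copies the result to the output
  -- array `1`.
  refine ⟨.seq q (.seq (fill (h + 1) 1 .tt) (.seq (p 3)
    (mapCol 0 1 1 .tt (.read 4 (.var 1) (.const 0))))), T, fun n G rev hG => ?_⟩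
  obtain ⟨s', t, hrun, ht, -, s₁, h1, ⟨u1, f1⟩, s₂, h2, ⟨u2, f2⟩, s₃, h3, ⟨-, f3⟩, -, f4⟩ :=
    hT (inputState G rev)
  have h0 : (inputState G rev).ivar 0 = n := rfl
  rw [h0] at h1 ht
  rw [h1] at h2
  rw [h2] at h3
  let I := ofFin G rev hG.1
  have hI : Env H' I s₂ := by
    refine ⟨h2, fun u v => ?_, fun a b => ?_, ?_⟩
    · rw [u2.iarr 0 (by omega), (u1 1).iarr 0 (by omega)]
      refine Iff.trans ?_ map_val_adj.symm
      simp only [inputState]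
      split_ifs with hh <;> simpa using hh
    · rw [u2.iarr 2 (by omega), f1]
      simp only [Finset.mem_filter, Finset.mem_product, Finset.mem_range, inputState]
      refine ⟨fun h => ?_, fun h => .inl ⟨?_, h⟩⟩
      · rcases h with h | h
        · exact h.2
        · simp at h
      · obtain ⟨ha, hb, -⟩ := map_val_adj.mp h
        exact ⟨ha, hb⟩
    · rw [u2.rarr, (u1 1).rarr]
      rfl
  have hlists : lists h s₂ 3 = fun v c => v < n ∧ c < h := by
    funext v c
    simp only [lists, h2, eq_iff_iff]
    refine ⟨fun hh => ⟨hh.1, hh.2.1⟩, fun hh => ⟨hh.1, hh.2, ?_⟩⟩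
    exact (f2 v (by omega) c (by omega)).mpr Fm.holds_tt
  obtain ⟨hv, hopt⟩ := f3 I hI
  rw [hlists] at hv hopt
  have hout : ∀ v : Fin n, s'.iarr 1 v 0 = col s₃ 4 v := fun v => by
    simpa [IExp.eval, col] using f4 v (by rw [h3]; omega)
  let φ : Fin n → Option (Fin h) := fun v =>
    if hc : 0 < col s₃ 4 v ∧ col s₃ 4 v - 1 < h then some ⟨_, hc.2⟩ else none
  have hφ : ∀ v : Fin n, col s₃ 4 v = (φ v).elim 0 (fun c => (c : ℕ) + 1) := by
    intro v
    rcases Nat.eq_zero_or_eq_succ_pred (col s₃ 4 v) with h0 | h0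
    · simp [φ, h0]
    · have := (hv.1 v v.2 _ h0).2
      simp only [φ]
      rw [dif_pos ⟨by omega, this⟩]
      exact h0
  refine ⟨s', t, φ, hrun, ht, fun v => (hout v).trans (hφ v), (valid_ofFin hφ).mp hv,
    fun ψ hψ => ?_⟩
  let x : ℕ → ℕ := fun v => if hv : v < n then (ψ ⟨v, hv⟩).elim 0 (fun c => (c : ℕ) + 1) else 0
  have hx : ∀ v : Fin n, x v = (ψ v).elim 0 (fun c => (c : ℕ) + 1) := fun v => by simp [x]
  rw [← total_ofFin (hG := hG.1) hx, ← total_ofFin (hG := hG.1) hφ]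
  -- A copy of the word in a component would be an induced copy of `F` in `G`.
  refine hopt ⟨fun r _ hcon => ?_, ⟨Finset.range h, by simp, fun v c hc => by simpa using hc.2⟩,
    fun v c hc => hc.1⟩ x ((valid_ofFin hx).mpr hψ)
  obtain ⟨f, hf⟩ := hw _ _ hcon
  have hfn : ∀ a, f a < n := fun a => (hf a).2.1.choose_spec.1
  refine hG.2 ⟨⟨⟨fun a => ⟨f a, hfn a⟩, fun a b hab => f.injective (Fin.mk.inj hab)⟩, ?_⟩⟩
  intro a b
  rw [← f.map_adj_iff]
  exact (SimpleGraph.map_adj_apply (f := Fin.valEmbedding) (a := ⟨f a, hfn a⟩)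
    (b := ⟨f b, hfn b⟩)).symm
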